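/- Let $(\bar M,\bar J,\bar g)$ be an almost Hermitian manifold, i.e. a Riemannian manifold with a smooth $(1,1)$-tensor $\bar J$ such that $\bar J^2=-\mathrm{id}$ and $\bar g(\bar JX,\bar JY)=\bar g(X,Y)$. Let $(M^{d+l},g)$, $d,l>0$, be a CR-submanifold of it, i.e. an (isometrically immersed) submanifold for which $D=\bar J(TM)\cap TM$ has constant real dimension $d$. Let $h$ be the second fundamental form of $M$, and let $R$, $\bar R$ be the curvature tensors of $g$, $\bar g$, with $R_{X,Y}=\nabla_X\nabla_Y-\nabla_Y\nabla_X-\nabla_{[X,Y]}$. For mutually orthogonal subspaces $V_1,\dots,V_k$ of $T_xM$ put $$S_m(V_1,\dots,V_k)=\sum_{i<j}\ \sum_{a,b} g\big(R_{e_a,e_b}e_b,e_a\big),$$ where, in the $(i,j)$-term, $e_a$ and $e_b$ run over orthonormal bases of $V_i$ and $V_j$. Let $\delta^+_{m,D}(n_1,\dots,n_k)(x)$ be the maximum of $S_m(V_1,\dots,V_k)$ over all mutually orthogonal subspaces $V_i\subset D_x$ with $\dim V_i=n_i$. Define $\bar S_m$ in the same way from $(\bar M,\bar g)$, and let $\bar\delta^+_m(n_1,\dots,n_k)(x)$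 be the maximum of $\bar S_m$ over all mutually orthogonal subspaces of $T_x\bar M$ of dimensions $n_1,\dots,n_k$. For $V\subset T_xM$ let $H_V=\sum_i h(e_i,e_i)$ for an orthonormal basis $(e_i)$ of $V$, and let $\mathcal H_{D_x}(s)=\max\{\|H_V\| : V\subset D_x,\ \dim V=s\}$. **Theorem.** Let $k\ge 2$ and let $n_1,\dots,n_k$ be natural numbers with $n_1+\dots+n_k=s\le d$. Then at every point $x\in M$ all the maxima above are attained and $$\delta^+_{m,D}(n_1,\dots,n_k)\ \le\ \bar\delta^+_m(n_1,\dots,n_k)+\frac{k-1}{2k}\cdot\begin{cases}\mathcal H_{D}(s)^2, & s<d,\\ \|H_{D}\|^2, & s=d.\end{cases}$$ Equality holds at $x$ if and only if there are mutually orthogonal subspaces $V_1,\dots,V_k$ of $D_x$ with $\dim V_i=n_i$ such that, with $V=V_1\oplus\dots\oplus V_k$: 1. $M$ is mixed totally geodesic on $V$, i.e. $h(X,Y)=0$ for all $X\in V_i$, $Y\in V_j$, $i\ne j$; 2. $H_{V_1}=\dots=H_{V_k}$; 3. $\|H_V\|=\mathcal H_{D_x}(s)$; 4. $\bar S_m(V_1,\dots,V_k)=\bar\delta^+_m(n_1,\dots,n_k)(x)$.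 -/

import Mathlib

open Bundle
open scoped Manifold ContDiff

noncomputable section

namespace CRMutual

/-! ### Riemannian geometry in charts

`M` is a manifold without boundary modelled on the finite-dimensional space `E`, its metric is the
inner product on the tangent spaces. The space `TangentSpace 𝓘(ℝ, E) x` is `E` itself, a tangent
vector at `x` being identified with its coordinates in the preferred chart at `x`; hence the
value at `x` of a tensor is read off from its components in that chart. -/

section Intrinsic

variable {E : Type*} [NormedAddCommGroup E] [NormedSpace ℝ E]
  {M : Type*} [TopologicalSpace M] [ChartedSpace E M]

instance tangentSpace_finiteDimensional [FiniteDimensional ℝ E] (x : M) :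
    FiniteDimensional ℝ (TangentSpace 𝓘(ℝ, E) x) :=
  inferInstanceAs (FiniteDimensional ℝ E)

variable [RiemannianBundle (fun x : M ↦ TangentSpace 𝓘(ℝ, E) x)]

/-- The components of the metric in the preferred chart `φ` at `x`, at the point `y` of
the target of `φ`: the bilinear form `(u, v) ↦ g (dφ⁻¹ u, dφ⁻¹ v)`. -/
def chartMetric (x : M) (y : E) : E →L[ℝ] E →L[ℝ] ℝ :=
  (innerSL ℝ (E := TangentSpace 𝓘(ℝ, E) ((extChartAt 𝓘(ℝ, E) x).symm y))).bilinearComp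
    (mfderiv 𝓘(ℝ, E) 𝓘(ℝ, E) (extChartAt 𝓘(ℝ, E) x).symm y)
    (mfderiv 𝓘(ℝ, E) 𝓘(ℝ, E) (extChartAt 𝓘(ℝ, E) x).symm y)

/-- Christoffel symbols of the first kind of the Levi-Civita connection in the chart at `x`:
`w ↦ (∂ᵤ g(v, w) + ∂ᵥ g(u, w) - ∂_w g(u, v)) / 2`. -/
def christoffelFirst (x : M) (y u v : E) : E →L[ℝ] ℝ :=
  (1 / 2 : ℝ) • (fderiv ℝ (chartMetric x) y u v + fderiv ℝ (chartMetric x) y v u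
    - ((fderiv ℝ (chartMetric x) y).flip u).flip v)

/-- Christoffel symbols of the second kind in the chart at `x`: `christoffel x y u v` is the
vector `Γ(u, v)` with `g (Γ(u, v), w) = christoffelFirst x y u v w` for all `w`. It is the
covariant derivative at `y`, in the direction `u`, of the vector field with
constant components `v`. -/
def christoffel (x : M) (y u v : E) : E :=
  (chartMetric x y).inverse (christoffelFirst x y u v)

/-- The curvature tensor `R_{u,v} w = ∇ᵤ ∇ᵥ w - ∇ᵥ ∇ᵤ w - ∇_{[u,v]} w` of the Levi-Civita
connection at `x`, computed in the chart at `x` on vector fields with constant components. -/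
def curvature (x : M) (u v w : TangentSpace 𝓘(ℝ, E) x) : TangentSpace 𝓘(ℝ, E) x :=
  let y : E := extChartAt 𝓘(ℝ, E) x x
  let Γ : E → E → E → E := christoffel x
  (fderiv ℝ (fun z ↦ Γ z v w) y u + Γ y u (Γ y v w)
    - (fderiv ℝ (fun z ↦ Γ z u w) y v + Γ y v (Γ y u w)) : E)

variable [FiniteDimensional ℝ E]

/-- The mutual curvature `S_m(V, W) = ∑ₐ ∑_b g (R_{eₐ, e_b} e_b, eₐ)` of a pair of subspaces of
the tangent space at `x`, where `eₐ`, `e_b` run over orthonormal bases of `V` and `W`. -/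
def mutualCurvaturePair {x : M} (V W : Submodule ℝ (TangentSpace 𝓘(ℝ, E) x)) : ℝ :=
  ∑ a, ∑ b, inner ℝ
    (curvature x (stdOrthonormalBasis ℝ V a : TangentSpace 𝓘(ℝ, E) x)
      (stdOrthonormalBasis ℝ W b) (stdOrthonormalBasis ℝ W b))
    (stdOrthonormalBasis ℝ V a : TangentSpace 𝓘(ℝ, E) x)

/-- The mutual curvature `S_m(V₁, …, V_k) = ∑_{i < j} S_m(Vᵢ, Vⱼ)`. -/
def mutualCurvature {x : M} {k : ℕ} (V : Fin k → Submodule ℝ (TangentSpace 𝓘(ℝ, E) x)) : ℝ :=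
  ∑ i, ∑ j ∈ Finset.Ioi i, mutualCurvaturePair (V i) (V j)

/-- `V₁, …, V_k` are mutually orthogonal subspaces of `D` with `dim Vᵢ = nᵢ`. -/
structure IsOrthogonalSystem {x : M} {k : ℕ} (D : Submodule ℝ (TangentSpace 𝓘(ℝ, E) x))
    (n : Fin k → ℕ) (V : Fin k → Submodule ℝ (TangentSpace 𝓘(ℝ, E) x)) : Prop where
  le : ∀ i, V i ≤ D
  finrank_eq : ∀ i, Module.finrank ℝ (V i) = n i
  orthogonal : ∀ i j, i ≠ j → V i ⟂ V j

/-- The values `S_m(V₁, …, V_k)` over all mutually orthogonal `V₁, …, V_k` in `D` with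
`dim Vᵢ = nᵢ`. -/
def mutualCurvatureValues {x : M} {k : ℕ} (D : Submodule ℝ (TangentSpace 𝓘(ℝ, E) x))
    (n : Fin k → ℕ) : Set ℝ :=
  {r | ∃ V : Fin k → Submodule ℝ (TangentSpace 𝓘(ℝ, E) x),
    IsOrthogonalSystem D n V ∧ mutualCurvature V = r}

/-- The mutual curvature invariant `δ⁺_{m,D}(n₁, …, n_k)(x)`, for `D` a subspace of the tangent
space at `x`; `δ⁺_m` is the case `D = ⊤`. -/
def deltaPlus {x : M} {k : ℕ} (D : Submodule ℝ (TangentSpace 𝓘(ℝ, E) x)) (n : Fin k → ℕ) : ℝ :=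
  sSup (mutualCurvatureValues D n)

end Intrinsic

/-! ### Almost Hermitian manifolds -/

/-- `J` is a smooth (1,1)-tensor with `J² = -1` and `g (J X, J Y) = g (X, Y)`, i.e. it makes the
Riemannian manifold `N` an almost Hermitian manifold. (Skew-symmetry of `J` and evenness of the
dimension follow.) -/
structure IsAlmostHermitian {E' : Type*} [NormedAddCommGroup E'] [NormedSpace ℝ E']
    {N : Type*} [TopologicalSpace N] [ChartedSpace E' N] [IsManifold 𝓘(ℝ, E') ∞ N]
    [RiemannianBundle (fun p : N ↦ TangentSpace 𝓘(ℝ, E') p)]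
    (J : ∀ p : N, TangentSpace 𝓘(ℝ, E') p →L[ℝ] TangentSpace 𝓘(ℝ, E') p) : Prop where
  contMDiff : ContMDiff 𝓘(ℝ, E') (𝓘(ℝ, E').prod 𝓘(ℝ, E' →L[ℝ] E')) ∞
    (fun p ↦ Bundle.TotalSpace.mk' (E' →L[ℝ] E')
      (E := fun p : N ↦ TangentSpace 𝓘(ℝ, E') p →L[ℝ] TangentSpace 𝓘(ℝ, E') p) p (J p))
  sq_eq_neg : ∀ (p : N) (X : TangentSpace 𝓘(ℝ, E') p), J p (J p X) = -X
  inner_eq : ∀ (p : N) (X Y : TangentSpace 𝓘(ℝ, E') p), inner ℝ (J p X) (J p Y) = inner ℝ X Y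

/-! ### Submanifolds

A submanifold is given by a smooth isometric immersion `f : M → N`; the tangent space of `M` at
`x` is seen in the tangent space of `N` at `f x` through the differential of `f`. -/

section Submanifold

variable {E : Type*} [NormedAddCommGroup E] [NormedSpace ℝ E]
  {M : Type*} [TopologicalSpace M] [ChartedSpace E M]
  {E' : Type*} [NormedAddCommGroup E'] [NormedSpace ℝ E']
  {N : Type*} [TopologicalSpace N] [ChartedSpace E' N]

/-- The tangent space of the submanifold at `x`, as a subspace of the ambient tangent space. -/
def tangentImage (f : M → N) (x : M) : Submodule ℝ (TangentSpace 𝓘(ℝ, E') (f x)) :=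
  LinearMap.range (mfderiv 𝓘(ℝ, E) 𝓘(ℝ, E') f x).toLinearMap

/-- The subspace `D_x = J(T_x M) ∩ T_x M`, as a subspace of `T_x M`. -/
def complexPart (f : M → N)
    (J : ∀ p : N, TangentSpace 𝓘(ℝ, E') p →L[ℝ] TangentSpace 𝓘(ℝ, E') p) (x : M) :
    Submodule ℝ (TangentSpace 𝓘(ℝ, E) x) :=
  ((tangentImage (E := E) (E' := E') f x).map (J (f x)).toLinearMap).comap
    (mfderiv 𝓘(ℝ, E) 𝓘(ℝ, E') f x).toLinearMap

/-- The image in `T_{f x} N` of a subspace of `T_x M`. -/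
def pushSubspace (f : M → N) {x : M} (V : Submodule ℝ (TangentSpace 𝓘(ℝ, E) x)) :
    Submodule ℝ (TangentSpace 𝓘(ℝ, E') (f x)) :=
  V.map (mfderiv 𝓘(ℝ, E) 𝓘(ℝ, E') f x).toLinearMap

variable [RiemannianBundle (fun x : M ↦ TangentSpace 𝓘(ℝ, E) x)]
  [RiemannianBundle (fun p : N ↦ TangentSpace 𝓘(ℝ, E') p)]

/-- `f` is a smooth isometric immersion. -/
structure IsIsometricImmersion (f : M → N) : Prop where
  contMDiff : ContMDiff 𝓘(ℝ, E) 𝓘(ℝ, E') ∞ f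
  inner_eq : ∀ (x : M) (u v : TangentSpace 𝓘(ℝ, E) x),
    inner ℝ (mfderiv 𝓘(ℝ, E) 𝓘(ℝ, E') f x u) (mfderiv 𝓘(ℝ, E) 𝓘(ℝ, E') f x v) = inner ℝ u v

/-- The isometric immersion `f` of `M = M^{d+l}`, `d, l > 0`, is a CR-submanifold of `(N, J, g)`:
`D = J(TM) ∩ TM` has constant real dimension `d`. -/
structure IsCRSubmanifold (f : M → N)
    (J : ∀ p : N, TangentSpace 𝓘(ℝ, E') p →L[ℝ] TangentSpace 𝓘(ℝ, E') p) (d l : ℕ) :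
    Prop where
  isIsometricImmersion : IsIsometricImmersion (E := E) (E' := E') f
  d_pos : 0 < d
  l_pos : 0 < l
  finrank_tangent : Module.finrank ℝ E = d + l
  finrank_complexPart : ∀ x : M, Module.finrank ℝ (complexPart (E := E) f J x) = d

/-- The ambient covariant derivative, at `x` and in the direction `u`, of the vector field along
`f` which is the image under `df` of the vector field on `M` with constant components `v` in the
chart at `x`. In the charts at `x` and `f x` it is `D²f (u, v) + Γ(df u, df v)`. -/
def ambientDerivative (f : M → N) {x : M} (u v : TangentSpace 𝓘(ℝ, E) x) :
    TangentSpace 𝓘(ℝ, E') (f x) :=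
  let F : E → E' := writtenInExtChartAt 𝓘(ℝ, E) 𝓘(ℝ, E') x f
  let y : E := extChartAt 𝓘(ℝ, E) x x
  (fderiv ℝ (fderiv ℝ F) y u v
    + christoffel (f x) (F y) (fderiv ℝ F y u) (fderiv ℝ F y v) : E')

variable [FiniteDimensional ℝ E] [FiniteDimensional ℝ E']

/-- The second fundamental form: the component of the ambient covariant derivative
normal to the submanifold. -/
def secondFundamentalForm (f : M → N) {x : M} (u v : TangentSpace 𝓘(ℝ, E) x) :
    TangentSpace 𝓘(ℝ, E') (f x) :=
  (tangentImage (E := E) (E' := E') f x)ᗮ.starProjection (ambientDerivative f u v)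

/-- The mean curvature vector `H_V = ∑ᵢ h(eᵢ, eᵢ)` of a subspace `V` of `T_x M`, where `eᵢ` is an
orthonormal basis of `V`. -/
def meanCurvature (f : M → N) {x : M} (V : Submodule ℝ (TangentSpace 𝓘(ℝ, E) x)) :
    TangentSpace 𝓘(ℝ, E') (f x) :=
  ∑ a, secondFundamentalForm f (stdOrthonormalBasis ℝ V a : TangentSpace 𝓘(ℝ, E) x)
    (stdOrthonormalBasis ℝ V a)

/-- The values `‖H_V‖` over all subspaces `V` of `D` with `dim V = s`. -/
def meanCurvatureValues (f : M → N) {x : M} (D : Submodule ℝ (TangentSpace 𝓘(ℝ, E) x))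
    (s : ℕ) : Set ℝ :=
  {r | ∃ V : Submodule ℝ (TangentSpace 𝓘(ℝ, E) x),
    V ≤ D ∧ Module.finrank ℝ V = s ∧ ‖meanCurvature (E' := E') f V‖ = r}

/-- `ℋ_D(s) = max {‖H_V‖ : V ⊂ D, dim V = s}`. -/
def maxMeanCurvature (f : M → N) {x : M} (D : Submodule ℝ (TangentSpace 𝓘(ℝ, E) x))
    (s : ℕ) : ℝ :=
  sSup (meanCurvatureValues (E' := E') f D s)

/-- `M` is mixed totally geodesic on `V₁ ⊕ … ⊕ V_k`: `h(X, Y) = 0` for `X ∈ Vᵢ`, `Y ∈ Vⱼ`,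
`i ≠ j`. -/
def IsMixedTotallyGeodesic (f : M → N) {x : M} {k : ℕ}
    (V : Fin k → Submodule ℝ (TangentSpace 𝓘(ℝ, E) x)) : Prop :=
  ∀ i j, i ≠ j → ∀ X ∈ V i, ∀ Y ∈ V j, secondFundamentalForm (E' := E') f X Y = 0

end Submanifold

end CRMutual

end

noncomputable section

namespace CRMutual

open Filter Topology

set_option maxSynthPendingDepth 3

/-! Summing the Gauss equation over orthonormal bases of orthogonal `V i`, `V j` gives `S_m(V i, V
j) = S̄_m(V i, V j) + ⟨H_i, H_j⟩ - ∑ ‖h(e_a, e_b)‖²` (`pairTrace_eq_of_gauss`). Over all pairs `i <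
j`, the identity `∑ ⟨H_i, H_j⟩ = (k-1)/(2k) ‖∑ H_i‖² - 1/(2k) ∑ ‖H_i - H_j‖²` (`sum_Ioi_inner_eq`)
and `H_V = ∑ H_i` turn this into `S_m = S̄_m + (k-1)/(2k) ‖H_V‖² - Q` with `Q ≥ 0`
(`mutualTrace_eq_of_gauss`). Here `Q = 0` exactly under conditions 1 and 2 (`defect_eq_zero_iff`).

At a system maximising `S_m`, bounding `S̄_m` and `‖H_V‖` by their maxima proves the inequality.
Equality makes all three estimates sharp, which gives conditions 1 to 4; conversely, a system with
these conditions realises the right-hand side. If `s = d`, the only competitor for `‖H_V‖` is `D`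
itself. Maxima exist because orthonormal frames form a compact set (`exists_isGreatest_of_frame`).

Since curvature and `h` are defined by chart formulas, the Gauss equation is derived from them: the
Christoffel symbols of a pulled-back metric are the tangential part of the ambient derivative
(`christoffelFirstMap_pullback`). Differentiating this and antisymmetrising cancels the third
derivatives of the immersion (`gauss_alongDerivative`). -/

/-! ### The Gauss equation for local metrics on normed spaces -/

section LocalMetric

set_option synthInstance.maxHeartbeats 100000

variable {E : Type*} [NormedAddCommGroup E] [NormedSpace ℝ E]
  {E' : Type*} [NormedAddCommGroup E'] [NormedSpace ℝ E']

/-- Christoffel symbols of the first kind of a metric `g`, as a trilinear map. -/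
def christoffelFirstMap (g : E → E →L[ℝ] E →L[ℝ] ℝ) (y : E) : E →L[ℝ] E →L[ℝ] E →L[ℝ] ℝ :=
  (1 / 2 : ℝ) • (fderiv ℝ g y + (fderiv ℝ g y).flip
    - (ContinuousLinearMap.flipₗᵢ ℝ E E ℝ).toContinuousLinearEquiv.toContinuousLinearMap.comp
      (fderiv ℝ g y).flip)

theorem christoffelFirstMap_apply (g : E → E →L[ℝ] E →L[ℝ] ℝ) (y u v w : E) :
    christoffelFirstMap g y u v w =
      (fderiv ℝ g y u v w + fderiv ℝ g y v u w - fderiv ℝ g y w u v) / 2 := by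
  simp [christoffelFirstMap]
  ring

/-- Christoffel symbols of the second kind of a metric `g`, as a bilinear map. -/
def christoffelMap (g : E → E →L[ℝ] E →L[ℝ] ℝ) (y : E) : E →L[ℝ] E →L[ℝ] E :=
  (ContinuousLinearMap.compL ℝ E (E →L[ℝ] ℝ) E (g y).inverse).comp (christoffelFirstMap g y)

theorem christoffelMap_apply (g : E → E →L[ℝ] E →L[ℝ] ℝ) (y u v : E) :
    christoffelMap g y u v = (g y).inverse (christoffelFirstMap g y u v) := rfl

theorem metric_christoffelMap {g : E → E →L[ℝ] E →L[ℝ] ℝ} {y : E} (hg : (g y).IsInvertible)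
    (u v : E) : g y (christoffelMap g y u v) = christoffelFirstMap g y u v := by
  rw [christoffelMap_apply, hg.self_apply_inverse]

/-- The curvature tensor of a metric `g`, as a trilinear map. -/
def curvatureMap (g : E → E →L[ℝ] E →L[ℝ] ℝ) (y : E) : E →L[ℝ] E →L[ℝ] E →L[ℝ] E :=
  let P := fderiv ℝ (christoffelMap g) y
  let Q := ((ContinuousLinearMap.compL ℝ E (E →L[ℝ] E) (E →L[ℝ] E)).flip (christoffelMap g y)).comp
    ((ContinuousLinearMap.compL ℝ E E E).comp (christoffelMap g y))
  P + Q - (P.flip + Q.flip)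

theorem curvatureMap_apply (g : E → E →L[ℝ] E →L[ℝ] ℝ) (y u v w : E) :
    curvatureMap g y u v w = fderiv ℝ (christoffelMap g) y u v w
      + christoffelMap g y u (christoffelMap g y v w)
      - (fderiv ℝ (christoffelMap g) y v u w
        + christoffelMap g y v (christoffelMap g y u w)) := rfl

/-- Inversion of operators is smooth at invertible ones, so Christoffel symbols inherit smoothness
from the metric and may be differentiated in the curvature. -/
theorem contDiffAt_christoffelMap [CompleteSpace E] {g : E → E →L[ℝ] E →L[ℝ] ℝ} {y : E}
    (hg : ContDiffAt ℝ ∞ g y) (hinv : (g y).IsInvertible) :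
    ContDiffAt ℝ ∞ (christoffelMap g) y := by
  have h1 : ContDiffAt ℝ ∞ (fderiv ℝ g) y := hg.fderiv_right (by simp)
  have h2 : ContDiffAt ℝ ∞ (fun z => (fderiv ℝ g z).flip) y :=
    ((ContinuousLinearMap.flipₗᵢ ℝ E E (E →L[ℝ] ℝ)).contDiff.contDiffAt).comp y h1
  have h3 : ContDiffAt ℝ ∞ (christoffelFirstMap g) y := by
    unfold christoffelFirstMap
    fun_prop
  have h4 : ContDiffAt ℝ ∞ (fun z => (g z).inverse) y :=
    (hinv.contDiffAt_map_inverse).comp y hg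
  unfold christoffelMap
  fun_prop

theorem eventually_isInvertible [CompleteSpace E] {g : E → E →L[ℝ] E →L[ℝ] ℝ} {y : E}
    (hg : ContinuousAt g y) (hinv : (g y).IsInvertible) : ∀ᶠ z in 𝓝 y, (g z).IsInvertible := by
  obtain ⟨e, he⟩ := hinv
  have := hg.eventually (he ▸ e.nhds)
  filter_upwards [this] with z hz
  obtain ⟨e', he'⟩ := hz
  exact ⟨e', he'⟩

theorem fderiv_metric_symm {g : E → E →L[ℝ] E →L[ℝ] ℝ} {y : E} (hg : DifferentiableAt ℝ g y)
    (hs : ∀ᶠ z in 𝓝 y, ∀ u v, g z u v = g z v u) (u v w : E) :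
    fderiv ℝ g y u v w = fderiv ℝ g y u w v := by
  have h1 := (hg.hasFDerivAt.clm_apply (hasFDerivAt_const v y)).clm_apply (hasFDerivAt_const w y)
  have h2 := (hg.hasFDerivAt.clm_apply (hasFDerivAt_const w y)).clm_apply (hasFDerivAt_const v y)
  have h3 := h1.unique (h2.congr_of_eventuallyEq (hs.mono fun z hz => hz v w))
  simpa using DFunLike.congr_fun h3 u

/-- Metric compatibility of the Levi-Civita connection, `∂ᵤ g(v, w) = g(∇ᵤ v, w) + g(v, ∇ᵤ w)` on
constant fields, with indices lowered. -/
theorem fderiv_metric_eq {g : E → E →L[ℝ] E →L[ℝ] ℝ} {y : E} (hg : DifferentiableAt ℝ g y)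
    (hs : ∀ᶠ z in 𝓝 y, ∀ u v, g z u v = g z v u) (u v w : E) :
    fderiv ℝ g y u v w = christoffelFirstMap g y u v w + christoffelFirstMap g y u w v := by
  rw [christoffelFirstMap_apply, christoffelFirstMap_apply, fderiv_metric_symm hg hs v u w,
    fderiv_metric_symm hg hs w u v, fderiv_metric_symm hg hs u v w]
  ring

/-- The covariant derivative along `F` of the image of a constant vector field. -/
def alongDerivative (G : E' → E' →L[ℝ] E' →L[ℝ] ℝ) (F : E → E') (y : E) : E →L[ℝ] E →L[ℝ] E' :=
  fderiv ℝ (fderiv ℝ F) y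
    + (christoffelMap G (F y)).bilinearComp (fderiv ℝ F y) (fderiv ℝ F y)

theorem alongDerivative_apply (G : E' → E' →L[ℝ] E' →L[ℝ] ℝ) (F : E → E') (y u v : E) :
    alongDerivative G F y u v = fderiv ℝ (fderiv ℝ F) y u v
      + christoffelMap G (F y) (fderiv ℝ F y u) (fderiv ℝ F y v) := rfl

variable {g : E → E →L[ℝ] E →L[ℝ] ℝ} {G : E' → E' →L[ℝ] E' →L[ℝ] ℝ} {F : E → E'} {y : E}

theorem fderiv_metric_apply (hg : DifferentiableAt ℝ g y) {X Y : E → E} {X' Y' : E →L[ℝ] E}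
    (hX : HasFDerivAt X X' y) (hY : HasFDerivAt Y Y' y) :
    HasFDerivAt (fun z => g z (X z) (Y z))
      ((g y (X y)).comp Y' + ((g y).comp X' + (fderiv ℝ g y).flip (X y)).flip (Y y)) y :=
  (hg.hasFDerivAt.clm_apply hX).clm_apply hY

theorem hasFDerivAt_metric_along (hF : DifferentiableAt ℝ F y) (hG : DifferentiableAt ℝ G (F y))
    {X Y : E → E'} {X' Y' : E →L[ℝ] E'}
    (hX : HasFDerivAt X X' y) (hY : HasFDerivAt Y Y' y) :
    HasFDerivAt (fun z => G (F z) (X z) (Y z))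
      ((G (F y) (X y)).comp Y' + ((G (F y)).comp X'
        + ((fderiv ℝ G (F y)).comp (fderiv ℝ F y)).flip (X y)).flip (Y y)) y :=
  ((hG.hasFDerivAt.comp y hF.hasFDerivAt).clm_apply hX).clm_apply hY

/-- The intrinsic connection is the tangential part of the ambient one. In the alternating sum of
derivatives of `G (F z) (dF b) (dF c)`, symmetry of `D²F` cancels all second-derivative terms except
the two copies of `G (D²F(u, v), dF w)`. -/
theorem christoffelFirstMap_pullback (hF : ContDiffAt ℝ 2 F y) (hG : DifferentiableAt ℝ G (F y))
    (hg : DifferentiableAt ℝ g y)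
    (hs : ∀ᶠ p in 𝓝 (F y), ∀ u v, G p u v = G p v u) (hinv : (G (F y)).IsInvertible)
    (hgG : ∀ᶠ z in 𝓝 y, ∀ u v, g z u v = G (F z) (fderiv ℝ F z u) (fderiv ℝ F z v))
    (u v w : E) :
    christoffelFirstMap g y u v w = G (F y) (alongDerivative G F y u v) (fderiv ℝ F y w) := by
  have hF1 : DifferentiableAt ℝ F y := hF.differentiableAt (by simp)
  have hF2 : DifferentiableAt ℝ (fderiv ℝ F) y :=
    (hF.fderiv_right (m := 1) (by norm_num)).differentiableAt (by simp)
  have hsym : ∀ a b, fderiv ℝ (fderiv ℝ F) y a b = fderiv ℝ (fderiv ℝ F) y b a :=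
    fun a b => (hF.isSymmSndFDerivAt (by simp)).eq a b
  have hD (a b c : E) : fderiv ℝ g y a b c =
      G (F y) (fderiv ℝ F y b) (fderiv ℝ (fderiv ℝ F) y a c)
      + (G (F y) (fderiv ℝ (fderiv ℝ F) y a b) (fderiv ℝ F y c)
        + fderiv ℝ G (F y) (fderiv ℝ F y a) (fderiv ℝ F y b) (fderiv ℝ F y c)) := by
    have h1 := (hg.hasFDerivAt.clm_apply (hasFDerivAt_const b y)).clm_apply
      (hasFDerivAt_const c y)
    have h2 := hasFDerivAt_metric_along hF1 hG
      (hF2.hasFDerivAt.clm_apply (hasFDerivAt_const b y))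
      (hF2.hasFDerivAt.clm_apply (hasFDerivAt_const c y))
    have h3 := h1.unique (h2.congr_of_eventuallyEq (hgG.mono fun z hz => hz b c))
    simpa using DFunLike.congr_fun h3 a
  have hsy := hs.self_of_nhds
  rw [alongDerivative_apply, map_add, _root_.add_apply, metric_christoffelMap hinv,
    christoffelFirstMap_apply, christoffelFirstMap_apply, hD, hD, hD, hsym v u, hsym w u,
    hsym w v, hsy (fderiv ℝ F y v), hsy (fderiv ℝ F y u) (fderiv ℝ (fderiv ℝ F) y v w)]
  ring

/-- Obtained by differentiating `g (Γ(v, w), z) = christoffelFirstMap g · v w z` and using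
compatibility, so the inverse metric is never differentiated explicitly. The derivative `L` is left
free so that the pullback formula can supply it. -/
theorem metric_fderiv_christoffelMap [CompleteSpace E] (hg : ContDiffAt ℝ ∞ g y)
    (hs : ∀ᶠ z in 𝓝 y, ∀ u v, g z u v = g z v u) (hinv : (g y).IsInvertible)
    (hinv' : ∀ᶠ z in 𝓝 y, (g z).IsInvertible) {L : E →L[ℝ] ℝ} {v w z : E}
    (hL : HasFDerivAt (fun p => christoffelFirstMap g p v w z) L y) (u : E) :
    g y (fderiv ℝ (christoffelMap g) y u v w + christoffelMap g y u (christoffelMap g y v w)) z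
      = L u - g y (christoffelMap g y v w) (christoffelMap g y u z) := by
  have hΓ := ((contDiffAt_christoffelMap hg hinv).differentiableAt (by simp)).hasFDerivAt
  have hg1 := hg.differentiableAt (by simp)
  have h1 := fderiv_metric_apply hg1
    ((hΓ.clm_apply (hasFDerivAt_const v y)).clm_apply (hasFDerivAt_const w y))
    (hasFDerivAt_const z y)
  have h2 := hL.unique (h1.congr_of_eventuallyEq
    (hinv'.mono fun p hp => by simp only [metric_christoffelMap hp]))
  have h3 := DFunLike.congr_fun h2 u
  simp at h3
  rw [h3, fderiv_metric_eq hg1 hs, ← metric_christoffelMap hinv, ← metric_christoffelMap hinv,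
    hs.self_of_nhds (christoffelMap g y v w)]
  simp only [map_add, add_apply]
  ring

theorem hasFDerivAt_alongDerivative (hF : ContDiffAt ℝ ∞ F y)
    (hΓ : DifferentiableAt ℝ (christoffelMap G) (F y)) (v w : E) :
    ∃ A' : E →L[ℝ] E', HasFDerivAt (fun z => alongDerivative G F z v w) A' y ∧
      ∀ u, A' u = fderiv ℝ (fderiv ℝ (fderiv ℝ F)) y u v w
        + (christoffelMap G (F y) (fderiv ℝ F y v) (fderiv ℝ (fderiv ℝ F) y u w)
          + (christoffelMap G (F y) (fderiv ℝ (fderiv ℝ F) y u v) (fderiv ℝ F y w)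
          + fderiv ℝ (christoffelMap G) (F y) (fderiv ℝ F y u) (fderiv ℝ F y v)
              (fderiv ℝ F y w))) := by
  have hF1 : DifferentiableAt ℝ F y := hF.differentiableAt (by simp)
  have hF2' := hF.fderiv_right (m := ∞) (by simp)
  have hF2 : DifferentiableAt ℝ (fderiv ℝ F) y := hF2'.differentiableAt (by simp)
  have hF3 : DifferentiableAt ℝ (fderiv ℝ (fderiv ℝ F)) y :=
    (hF2'.fderiv_right (m := ∞) (by simp)).differentiableAt (by simp)
  have h1 := (hF3.hasFDerivAt.clm_apply (hasFDerivAt_const v y)).clm_apply (hasFDerivAt_const w y)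
  have h2 := ((hΓ.hasFDerivAt.comp y hF1.hasFDerivAt).clm_apply
    (hF2.hasFDerivAt.clm_apply (hasFDerivAt_const v y))).clm_apply
    (hF2.hasFDerivAt.clm_apply (hasFDerivAt_const w y))
  refine ⟨_, h1.add h2, fun u => ?_⟩
  simp

/-- The Gauss equation, in terms of the ambient covariant derivative. -/
theorem gauss_alongDerivative [CompleteSpace E] [CompleteSpace E']
    (hF : ContDiffAt ℝ ∞ F y) (hG : ContDiffAt ℝ ∞ G (F y)) (hg : ContDiffAt ℝ ∞ g y)
    (hs : ∀ᶠ p in 𝓝 (F y), ∀ u v, G p u v = G p v u)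
    (hinv : (g y).IsInvertible) (hinvG : (G (F y)).IsInvertible)
    (hgG : ∀ᶠ z in 𝓝 y, ∀ u v, g z u v = G (F z) (fderiv ℝ F z u) (fderiv ℝ F z v))
    (u v w z : E) :
    g y (curvatureMap g y u v w) z
      = G (F y) (curvatureMap G (F y) (fderiv ℝ F y u) (fderiv ℝ F y v) (fderiv ℝ F y w))
          (fderiv ℝ F y z)
        + G (F y) (alongDerivative G F y v w) (alongDerivative G F y u z)
        - G (F y) (alongDerivative G F y u w) (alongDerivative G F y v z)
        - g y (christoffelMap g y v w) (christoffelMap g y u z)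
        + g y (christoffelMap g y u w) (christoffelMap g y v z) := by
  have hF1 : DifferentiableAt ℝ F y := hF.differentiableAt (by simp)
  have hF2' := hF.fderiv_right (m := ∞) (by simp)
  have hF2 : DifferentiableAt ℝ (fderiv ℝ F) y := hF2'.differentiableAt (by simp)
  have hsym2 : ∀ a b, fderiv ℝ (fderiv ℝ F) y a b = fderiv ℝ (fderiv ℝ F) y b a :=
    fun a b => (hF.isSymmSndFDerivAt (by
    rw [minSmoothness_of_isRCLikeNormedField]; exact WithTop.coe_le_coe.2 le_top)).eq a b
  have hsym3 : ∀ a b, fderiv ℝ (fderiv ℝ (fderiv ℝ F)) y a b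
      = fderiv ℝ (fderiv ℝ (fderiv ℝ F)) y b a :=
    fun a b => (hF2'.isSymmSndFDerivAt (by
    rw [minSmoothness_of_isRCLikeNormedField]; exact WithTop.coe_le_coe.2 le_top)).eq a b
  have hΓ := (contDiffAt_christoffelMap hG hinvG).differentiableAt (by simp)
  have hG1 : DifferentiableAt ℝ G (F y) := hG.differentiableAt (by simp)
  have hFc : Tendsto F (𝓝 y) (𝓝 (F y)) := hF1.continuousAt
  have hgs : ∀ᶠ p in 𝓝 y, ∀ u v, g p u v = g p v u := by
    filter_upwards [hFc.eventually hs, hgG] with p hp hp' u v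
    rw [hp', hp', hp]
  -- This identity is going to be differentiated at `y`, so it is needed on a neighbourhood and
  -- every hypothesis is propagated to nearby points.
  have hfirst : ∀ᶠ p in 𝓝 y, ∀ a b c, christoffelFirstMap g p a b c
      = G (F p) (alongDerivative G F p a b) (fderiv ℝ F p c) := by
    have e1 : ∀ᶠ p in 𝓝 (F y), DifferentiableAt ℝ G p := by
      filter_upwards [(hG.of_le (m := 1) (by simp)).eventually (by simp)] with p hp
      exact hp.differentiableAt (by simp)
    have e2 : ∀ᶠ p in 𝓝 y, DifferentiableAt ℝ g p := by
      filter_upwards [(hg.of_le (m := 1) (by simp)).eventually (by simp)] with p hp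
      exact hp.differentiableAt (by simp)
    have e3 : ∀ᶠ p in 𝓝 y, ContDiffAt ℝ 2 F p :=
      (hF.of_le (m := 2) (WithTop.coe_le_coe.2 le_top)).eventually (by decide)
    filter_upwards [e3, hFc.eventually e1, e2, hFc.eventually hs.eventually_nhds,
      hFc.eventually (eventually_isInvertible hG.continuousAt hinvG), hgG.eventually_nhds]
      with p h1 h2 h3 h4 h5 h6
    exact christoffelFirstMap_pullback h1 h2 h3 h4 h5 h6
  -- One half of the curvature, before antisymmetrising in `a`, `b`. Each half still contains third
  -- derivatives of `F`.
  have key : ∀ a b : E,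
      g y (fderiv ℝ (christoffelMap g) y a b w + christoffelMap g y a (christoffelMap g y b w)) z
      = G (F y) (fderiv ℝ (fderiv ℝ (fderiv ℝ F)) y a b w
        + (christoffelMap G (F y) (fderiv ℝ F y b) (fderiv ℝ (fderiv ℝ F) y a w)
          + (christoffelMap G (F y) (fderiv ℝ (fderiv ℝ F) y a b) (fderiv ℝ F y w)
          + fderiv ℝ (christoffelMap G) (F y) (fderiv ℝ F y a) (fderiv ℝ F y b)
              (fderiv ℝ F y w)))
        + christoffelMap G (F y) (fderiv ℝ F y a) (fderiv ℝ (fderiv ℝ F) y b w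
          + christoffelMap G (F y) (fderiv ℝ F y b) (fderiv ℝ F y w))) (fderiv ℝ F y z)
        + G (F y) (alongDerivative G F y b w) (alongDerivative G F y a z)
        - g y (christoffelMap g y b w) (christoffelMap g y a z) := by
    intro a b
    obtain ⟨A', hA, hA'⟩ := hasFDerivAt_alongDerivative hF hΓ b w
    have h1 := hasFDerivAt_metric_along hF1 hG1 hA
      (hF2.hasFDerivAt.clm_apply (hasFDerivAt_const z y))
    have h2 := h1.congr_of_eventuallyEq (hfirst.mono fun p hp => hp b w z)
    rw [metric_fderiv_christoffelMap hg hgs hinv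
      (eventually_isInvertible hg.continuousAt hinv) h2, ← hA', ← alongDerivative_apply]
    simp only [add_apply, ContinuousLinearMap.comp_apply,
      ContinuousLinearMap.flip_apply, map_add, ContinuousLinearMap.comp_zero, zero_add]
    rw [fderiv_metric_eq hG1 hs, ← metric_christoffelMap hinvG, ← metric_christoffelMap hinvG,
      alongDerivative_apply G F y a z, map_add,
      hs.self_of_nhds (christoffelMap G (F y) (fderiv ℝ F y a) (fderiv ℝ F y z))]
    ring
  rw [curvatureMap_apply, map_sub, sub_apply, key, key, curvatureMap_apply]
  -- `D³F` and `Γ(D²F(u, v), dF w)` are symmetric in `u`, `v`; the terms `Γ(dF v, D²F(u, w))` and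
  -- `Γ(dF u, D²F(v, w))` occur together in both halves. All of them drop out.
  rw [hsym3 v u, hsym2 v u]
  simp only [map_add, map_sub, add_apply, sub_apply]
  ring

end LocalMetric

/-! ### The Riemannian metric in the preferred chart. -/

section ChartMetric

variable {E : Type*} [NormedAddCommGroup E] [NormedSpace ℝ E]
  {M : Type*} [TopologicalSpace M] [ChartedSpace E M]

/-- The tangent space at `x` is trivialised by the chart at `x` itself, so chart components at the
centre are the intrinsic ones. -/
theorem mfderiv_extChartAt_symm_self [IsManifold 𝓘(ℝ, E) ∞ M] (x : M) (u : E) :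
    mfderiv 𝓘(ℝ, E) 𝓘(ℝ, E) (extChartAt 𝓘(ℝ, E) x).symm (extChartAt 𝓘(ℝ, E) x x) u = u := by
  have : IsManifold 𝓘(ℝ, E) 1 M := IsManifold.of_le (n := ∞) (by simp)
  have h := mfderivWithin_range_extChartAt_symm (I := 𝓘(ℝ, E)) (x := x)
  rw [modelWithCornersSelf_coe, Set.range_id, mfderivWithin_univ] at h
  exact DFunLike.congr_fun h u

variable [RiemannianBundle (fun x : M ↦ TangentSpace 𝓘(ℝ, E) x)]

/-- The inner product of the tangent space at `p`, on the model space. -/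
def modelInner (p : M) (u v : E) : ℝ :=
  inner ℝ (show TangentSpace 𝓘(ℝ, E) p from u) (show TangentSpace 𝓘(ℝ, E) p from v)

theorem chartMetric_apply (x : M) (y u v : E) :
    chartMetric x y u v = modelInner (E := E) ((extChartAt 𝓘(ℝ, E) x).symm y)
      (mfderiv 𝓘(ℝ, E) 𝓘(ℝ, E) (extChartAt 𝓘(ℝ, E) x).symm y u)
      (mfderiv 𝓘(ℝ, E) 𝓘(ℝ, E) (extChartAt 𝓘(ℝ, E) x).symm y v) := rfl

theorem chartMetric_symm (x : M) (y u v : E) : chartMetric x y u v = chartMetric x y v u :=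
  real_inner_comm (F := TangentSpace 𝓘(ℝ, E) ((extChartAt 𝓘(ℝ, E) x).symm y)) _ _

theorem chartMetric_self [IsManifold 𝓘(ℝ, E) ∞ M] (x : M) (u v : E) :
    chartMetric x (extChartAt 𝓘(ℝ, E) x x) u v = modelInner (E := E) x u v := by
  rw [chartMetric_apply, mfderiv_extChartAt_symm_self, mfderiv_extChartAt_symm_self,
    extChartAt_to_inv]

/-- The tangent map of the inverse chart makes `y ↦ dφ⁻¹ v` a smooth field, and the metric of two
smooth fields is smooth. In finite dimension these entries control the bundled form. -/
theorem contDiffOn_chartMetric [FiniteDimensional ℝ E] [IsManifold 𝓘(ℝ, E) ∞ M]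
    [IsContMDiffRiemannianBundle 𝓘(ℝ, E) ∞ E (fun x : M ↦ TangentSpace 𝓘(ℝ, E) x)] (x : M) :
    ContDiffOn ℝ ∞ (chartMetric x) (extChartAt 𝓘(ℝ, E) x).target := by
  set s := (extChartAt 𝓘(ℝ, E) x).target with hs
  have hso : IsOpen s := isOpen_extChartAt_target x
  have hT : ContMDiffOn 𝓘(ℝ, E).tangent 𝓘(ℝ, E).tangent ∞
      (tangentMapWithin 𝓘(ℝ, E) 𝓘(ℝ, E) (extChartAt 𝓘(ℝ, E) x).symm s)
      (Bundle.TotalSpace.proj ⁻¹' s) :=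
    (contMDiffOn_extChartAt_symm (n := ∞) x).contMDiffOn_tangentMapWithin (by simp)
      hso.uniqueMDiffOn
  have hv (v : E) : ContMDiffOn 𝓘(ℝ, E) 𝓘(ℝ, E).tangent ∞
      (fun y : E => (⟨(extChartAt 𝓘(ℝ, E) x).symm y,
        mfderiv 𝓘(ℝ, E) 𝓘(ℝ, E) (extChartAt 𝓘(ℝ, E) x).symm y v⟩ : TangentBundle 𝓘(ℝ, E) M)) s := by
    have h1 : ContMDiffOn 𝓘(ℝ, E) 𝓘(ℝ, E).tangent ∞
        (fun y : E => (⟨y, v⟩ : TangentBundle 𝓘(ℝ, E) E)) s :=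
      contMDiffOn_vectorSpace_iff_contDiffOn.2 contDiffOn_const
    refine (hT.comp h1 fun y hy => hy).congr fun y hy => ?_
    simp only [Function.comp_apply, tangentMapWithin]
    rw [mfderivWithin_of_mem_nhds (hso.mem_nhds hy)]
  refine contDiffOn_clm_apply.2 fun u => contDiffOn_clm_apply.2 fun v => ?_
  exact contMDiffOn_iff_contDiffOn.1 (ContMDiffOn.inner_bundle (IB := 𝓘(ℝ, E)) (F := E)
    (E := fun p : M ↦ TangentSpace 𝓘(ℝ, E) p) (b := (extChartAt 𝓘(ℝ, E) x).symm)
    (v := fun y => mfderiv 𝓘(ℝ, E) 𝓘(ℝ, E) (extChartAt 𝓘(ℝ, E) x).symm y u)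
    (w := fun y => mfderiv 𝓘(ℝ, E) 𝓘(ℝ, E) (extChartAt 𝓘(ℝ, E) x).symm y v) (hv u) (hv v))

theorem contDiffAt_chartMetric [FiniteDimensional ℝ E] [IsManifold 𝓘(ℝ, E) ∞ M]
    [IsContMDiffRiemannianBundle 𝓘(ℝ, E) ∞ E (fun x : M ↦ TangentSpace 𝓘(ℝ, E) x)] (x : M) :
    ContDiffAt ℝ ∞ (chartMetric x) (extChartAt 𝓘(ℝ, E) x x) :=
  (contDiffOn_chartMetric x).contDiffAt (extChartAt_target_mem_nhds x)

theorem isInvertible_chartMetric [FiniteDimensional ℝ E] [IsManifold 𝓘(ℝ, E) ∞ M] (x : M) :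
    (chartMetric x (extChartAt 𝓘(ℝ, E) x x)).IsInvertible := by
  set g := chartMetric x (extChartAt 𝓘(ℝ, E) x x) with hg
  have hinj : Function.Injective g := by
    rw [injective_iff_map_eq_zero]
    intro u hu
    have h := chartMetric_self x u u
    rw [← hg, hu, zero_apply] at h
    exact inner_self_eq_zero (𝕜 := ℝ) (E := TangentSpace 𝓘(ℝ, E) x) |>.1 h.symm
  have hdim : Module.finrank ℝ E = Module.finrank ℝ (E →L[ℝ] ℝ) := by
    rw [← LinearMap.toContinuousLinearMap.finrank_eq]
    exact (Subspace.dual_finrank_eq (K := ℝ) (V := E)).symm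
  refine ⟨(LinearMap.linearEquivOfInjective g.toLinearMap hinj hdim).toContinuousLinearEquiv, ?_⟩
  ext u v
  rfl

theorem christoffel_eq (x : M) (y u v : E) :
    christoffel x y u v = christoffelMap (chartMetric x) y u v := by
  rw [christoffel, christoffelMap_apply]
  congr 1

/-- `curvature` differentiates `Γ` on fixed vectors, `curvatureMap` differentiates the bundled `Γ`;
differentiability of the latter lets evaluation and derivative commute. -/
theorem curvature_eq [FiniteDimensional ℝ E] [IsManifold 𝓘(ℝ, E) ∞ M]
    [IsContMDiffRiemannianBundle 𝓘(ℝ, E) ∞ E (fun x : M ↦ TangentSpace 𝓘(ℝ, E) x)] (x : M)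
    (u v w : E) :
    curvature x u v w = curvatureMap (chartMetric x) (extChartAt 𝓘(ℝ, E) x x) u v w := by
  have hΓ := (contDiffAt_christoffelMap (contDiffAt_chartMetric (E := E) x)
    (isInvertible_chartMetric x)).differentiableAt (by simp)
  have h (a b c : E) : fderiv ℝ (fun z ↦ christoffel x z b c) (extChartAt 𝓘(ℝ, E) x x) a
      = fderiv ℝ (christoffelMap (chartMetric x)) (extChartAt 𝓘(ℝ, E) x x) a b c := by
    simp only [christoffel_eq]
    have h1 := (hΓ.hasFDerivAt.clm_apply (hasFDerivAt_const b _)).clm_apply (hasFDerivAt_const c _)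
    rw [h1.fderiv]
    simp
  rw [curvatureMap_apply]
  unfold curvature
  simp only
  rw [h, h, christoffel_eq, christoffel_eq, christoffel_eq, christoffel_eq]

end ChartMetric

/-! ### Immersions read in charts. -/

section Written

variable {E : Type*} [NormedAddCommGroup E] [NormedSpace ℝ E]
  {M : Type*} [TopologicalSpace M] [ChartedSpace E M]
  {E' : Type*} [NormedAddCommGroup E'] [NormedSpace ℝ E']
  {N : Type*} [TopologicalSpace N] [ChartedSpace E' N] {f : M → N}

theorem contDiffAt_writtenInExtChartAt (hf : ContMDiff 𝓘(ℝ, E) 𝓘(ℝ, E') ∞ f) (x : M) :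
    ContDiffAt ℝ ∞ (writtenInExtChartAt 𝓘(ℝ, E) 𝓘(ℝ, E') x f) (extChartAt 𝓘(ℝ, E) x x) := by
  have h := (contMDiffAt_iff.1 (hf x)).2
  rwa [modelWithCornersSelf_coe, Set.range_id, contDiffWithinAt_univ] at h

theorem fderiv_writtenInExtChartAt (hf : ContMDiff 𝓘(ℝ, E) 𝓘(ℝ, E') ∞ f) (x : M) :
    fderiv ℝ (writtenInExtChartAt 𝓘(ℝ, E) 𝓘(ℝ, E') x f) (extChartAt 𝓘(ℝ, E) x x)
      = mfderiv 𝓘(ℝ, E) 𝓘(ℝ, E') f x := by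
  rw [(hf.mdifferentiable (by simp) x).mfderiv, modelWithCornersSelf_coe, Set.range_id,
    fderivWithin_univ]

end Written

section Immersion

variable {E : Type*} [NormedAddCommGroup E] [NormedSpace ℝ E]
  {M : Type*} [TopologicalSpace M] [ChartedSpace E M] [IsManifold 𝓘(ℝ, E) ∞ M]
  [RiemannianBundle (fun x : M ↦ TangentSpace 𝓘(ℝ, E) x)]
  {E' : Type*} [NormedAddCommGroup E'] [NormedSpace ℝ E']
  {N : Type*} [TopologicalSpace N] [ChartedSpace E' N] [IsManifold 𝓘(ℝ, E') ∞ N]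
  [RiemannianBundle (fun p : N ↦ TangentSpace 𝓘(ℝ, E') p)]
  {f : M → N}

/-- Differentiate `ψ⁻¹ ∘ F = f ∘ φ⁻¹` at points near the centre and use that `f` is isometric there.
-/
theorem chartMetric_pullback (hf : IsIsometricImmersion (E := E) (E' := E') f) (x : M) :
    ∀ᶠ y in 𝓝 (extChartAt 𝓘(ℝ, E) x x), ∀ u v : E, chartMetric x y u v
      = chartMetric (f x) (writtenInExtChartAt 𝓘(ℝ, E) 𝓘(ℝ, E') x f y)
        (fderiv ℝ (writtenInExtChartAt 𝓘(ℝ, E) 𝓘(ℝ, E') x f) y u)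
        (fderiv ℝ (writtenInExtChartAt 𝓘(ℝ, E) 𝓘(ℝ, E') x f) y v) := by
  set F := writtenInExtChartAt 𝓘(ℝ, E) 𝓘(ℝ, E') x f with hF
  set φ := extChartAt 𝓘(ℝ, E) x with hφ
  set ψ := extChartAt 𝓘(ℝ, E') (f x) with hψ
  have h1 : ∀ᶠ y in 𝓝 (φ x), y ∈ φ.target := extChartAt_target_mem_nhds x
  have h2 : ∀ᶠ y in 𝓝 (φ x), f (φ.symm y) ∈ ψ.source := by
    have hc : ContinuousAt (f ∘ φ.symm) (φ x) := by
      refine ContinuousAt.comp ?_ (continuousAt_extChartAt_symm x)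
      exact hf.contMDiff.continuous.continuousAt
    refine hc.eventually (?_ : ψ.source ∈ _)
    rw [Function.comp_apply, hφ, extChartAt_to_inv]
    exact extChartAt_source_mem_nhds (f x)
  have h3 := (contDiffAt_writtenInExtChartAt hf.contMDiff x).of_le
    (m := 1) (by simp) |>.eventually (by simp)
  filter_upwards [h1.eventually_nhds, h2.eventually_nhds, h3] with y hy1 hy2 hy3 u v
  have hy1' := hy1.self_of_nhds
  have hy2' := hy2.self_of_nhds
  have hφd : MDifferentiableAt 𝓘(ℝ, E) 𝓘(ℝ, E) φ.symm y :=
    ((contMDiffOn_extChartAt_symm (n := ∞) x).contMDiffAt hy1).mdifferentiableAt (by simp)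
  have hFt : F y ∈ ψ.target := ψ.map_source hy2'
  have hψd : MDifferentiableAt 𝓘(ℝ, E') 𝓘(ℝ, E') ψ.symm (F y) :=
    ((contMDiffOn_extChartAt_symm (n := ∞) (f x)).contMDiffAt
      ((isOpen_extChartAt_target (f x)).mem_nhds hFt)).mdifferentiableAt (by simp)
  have hFd : MDifferentiableAt 𝓘(ℝ, E) 𝓘(ℝ, E') F y :=
    (hy3.differentiableAt (by simp)).mdifferentiableAt
  have heq : ψ.symm ∘ F =ᶠ[𝓝 y] f ∘ φ.symm := by
    filter_upwards [hy2] with z hz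
    exact ψ.left_inv hz
  have hd := heq.mfderiv_eq (I := 𝓘(ℝ, E)) (I' := 𝓘(ℝ, E'))
  rw [mfderiv_comp y hψd hFd, mfderiv_comp y (hf.contMDiff.mdifferentiable (by simp) _) hφd,
    mfderiv_eq_fderiv] at hd
  have hd' (w : E) : mfderiv 𝓘(ℝ, E') 𝓘(ℝ, E') ψ.symm (F y) (fderiv ℝ F y w)
      = mfderiv 𝓘(ℝ, E) 𝓘(ℝ, E') f (φ.symm y) (mfderiv 𝓘(ℝ, E) 𝓘(ℝ, E) φ.symm y w) :=
    DFunLike.congr_fun hd w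
  have hp : (extChartAt 𝓘(ℝ, E') (f x)).symm (F y) = f (φ.symm y) := heq.self_of_nhds
  rw [chartMetric_apply, chartMetric_apply, hd', hd', hp]
  exact (hf.inner_eq _ _ _).symm

end Immersion

/-- The hypotheses identify `k`, `m` as the orthogonal projections of `a`, `b` onto `K`, so this is
Pythagoras in polarised form. -/
theorem inner_eq_add_inner_starProjection_orthogonal {V : Type*} [NormedAddCommGroup V]
    [InnerProductSpace ℝ V] (K : Submodule ℝ V) [K.HasOrthogonalProjection] {a b k m : V}
    (hk : k ∈ K) (hm : m ∈ K) (ha : ∀ z ∈ K, inner ℝ a z = inner ℝ k z)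
    (hb : ∀ z ∈ K, inner ℝ b z = inner ℝ m z) :
    inner ℝ a b = inner ℝ k m + inner ℝ (Kᗮ.starProjection a) (Kᗮ.starProjection b) := by
  have h {c n : V} (hn : n ∈ K) (hc : ∀ z ∈ K, inner ℝ c z = inner ℝ n z) :
      Kᗮ.starProjection c = c - n := by
    have h1 : K.starProjection c = n :=
      (K.eq_starProjection_of_mem_of_inner_eq_zero hn fun z hz => by
        rw [inner_sub_left, hc z hz, sub_self])
    rw [K.starProjection_orthogonal_val, h1]
  rw [h hk ha, h hm hb, inner_sub_left, inner_sub_right, inner_sub_right, ha m hm,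
    real_inner_comm, real_inner_comm b k, hb k hk, real_inner_comm m k]
  ring

/-! ### Bilinearity and symmetry of the second fundamental form. -/

section Immersed

variable {E : Type*} [NormedAddCommGroup E] [NormedSpace ℝ E]
  {M : Type*} [TopologicalSpace M] [ChartedSpace E M]
  {E' : Type*} [NormedAddCommGroup E'] [NormedSpace ℝ E']
  {N : Type*} [TopologicalSpace N] [ChartedSpace E' N]

theorem writtenInExtChartAt_self (f : M → N) (x : M) :
    writtenInExtChartAt 𝓘(ℝ, E) 𝓘(ℝ, E') x f (extChartAt 𝓘(ℝ, E) x x)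
      = extChartAt 𝓘(ℝ, E') (f x) (f x) := by
  simp [writtenInExtChartAt]

variable [RiemannianBundle (fun p : N ↦ TangentSpace 𝓘(ℝ, E') p)]

theorem ambientDerivative_eq (f : M → N) (x : M) (u v : E) :
    ambientDerivative (E := E) (E' := E') (x := x) f u v
      = alongDerivative (chartMetric (f x)) (writtenInExtChartAt 𝓘(ℝ, E) 𝓘(ℝ, E') x f)
        (extChartAt 𝓘(ℝ, E) x x) u v := by
  unfold ambientDerivative
  simp only
  rw [christoffel_eq, alongDerivative_apply]

variable [FiniteDimensional ℝ E']

/-- Stated as existence so that the later trace arguments see an abstract bilinear map instead of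
chart expressions. -/
theorem exists_secondFundamentalForm_bilinear (f : M → N) (x : M) :
    ∃ h : TangentSpace 𝓘(ℝ, E) x →ₗ[ℝ] TangentSpace 𝓘(ℝ, E) x →ₗ[ℝ]
      TangentSpace 𝓘(ℝ, E') (f x), ∀ u v, secondFundamentalForm f u v = h u v := by
  let A : E →ₗ[ℝ] E →ₗ[ℝ] E' :=
    (alongDerivative (chartMetric (f x)) (writtenInExtChartAt 𝓘(ℝ, E) 𝓘(ℝ, E') x f)
        (extChartAt 𝓘(ℝ, E) x x)).toLinearMap₁₂
  let P : E' →ₗ[ℝ] E' := (tangentImage (E := E) (E' := E') f x)ᗮ.starProjection.toLinearMap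
  let B := A.compr₂ P
  have h : ∀ u v : E, secondFundamentalForm (E := E) (E' := E') (x := x) f u v = B u v :=
    fun u v => congrArg P (ambientDerivative_eq f x u v)
  clear_value B
  exact ⟨B, h⟩

variable [RiemannianBundle (fun x : M ↦ TangentSpace 𝓘(ℝ, E) x)] [IsManifold 𝓘(ℝ, E') ∞ N]
  [IsContMDiffRiemannianBundle 𝓘(ℝ, E') ∞ E' (fun p : N ↦ TangentSpace 𝓘(ℝ, E') p)] {f : M → N}

/-- The ambient derivative is already symmetric before projection: `D²F` is, and the Levi-Civita
connection has no torsion. -/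
theorem secondFundamentalForm_symm (hf : IsIsometricImmersion (E := E) (E' := E') f) (x : M)
    (u v : TangentSpace 𝓘(ℝ, E) x) :
    secondFundamentalForm (E' := E') f u v = secondFundamentalForm f v u := by
  unfold secondFundamentalForm
  congr 1
  have hF := contDiffAt_writtenInExtChartAt hf.contMDiff x
  have hsym := hF.isSymmSndFDerivAt (by
    rw [minSmoothness_of_isRCLikeNormedField]; exact WithTop.coe_le_coe.2 le_top)
  have hΓ (a b : E') : christoffelMap (chartMetric (f x)) (extChartAt 𝓘(ℝ, E') (f x) (f x)) a b
      = christoffelMap (chartMetric (f x)) (extChartAt 𝓘(ℝ, E') (f x) (f x)) b a := by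
    rw [christoffelMap_apply, christoffelMap_apply]
    congr 1
    ext w
    rw [christoffelFirstMap_apply, christoffelFirstMap_apply,
      fderiv_metric_symm ((contDiffAt_chartMetric (f x)).differentiableAt (by simp))
        (.of_forall fun z => chartMetric_symm (f x) z) w a b]
    ring
  have h (a b : E) : ambientDerivative (E := E) (E' := E') (x := x) f a b
      = ambientDerivative (E := E) (E' := E') (x := x) f b a := by
    rw [ambientDerivative_eq, ambientDerivative_eq, alongDerivative_apply, alongDerivative_apply,
      writtenInExtChartAt_self, hΓ, hsym.eq]
  exact h u v

end Immersed

/-! ### The Gauss equation on manifolds. -/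

section Gauss

variable {E : Type*} [NormedAddCommGroup E] [NormedSpace ℝ E] [FiniteDimensional ℝ E]
  {M : Type*} [TopologicalSpace M] [ChartedSpace E M] [IsManifold 𝓘(ℝ, E) ∞ M]
  [RiemannianBundle (fun x : M ↦ TangentSpace 𝓘(ℝ, E) x)]
  [IsContMDiffRiemannianBundle 𝓘(ℝ, E) ∞ E (fun x : M ↦ TangentSpace 𝓘(ℝ, E) x)]

theorem exists_curvature_linear (x : M) :
    ∃ R : TangentSpace 𝓘(ℝ, E) x →ₗ[ℝ] TangentSpace 𝓘(ℝ, E) x →ₗ[ℝ]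
      TangentSpace 𝓘(ℝ, E) x →ₗ[ℝ] TangentSpace 𝓘(ℝ, E) x,
      ∀ u v w, curvature x u v w = R u v w := by
  let C := curvatureMap (chartMetric x) (extChartAt 𝓘(ℝ, E) x x)
  let C' : E →ₗ[ℝ] E →ₗ[ℝ] E →ₗ[ℝ] E := LinearMap.mk₂ ℝ (fun u v => (C u v).toLinearMap)
    (fun _ _ _ => by ext; simp) (fun _ _ _ => by ext; simp) (fun _ _ _ => by ext; simp)
    (fun _ _ _ => by ext; simp)
  have h : ∀ u v w : E, curvature (E := E) x u v w = C' u v w := fun u v w => by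
    rw [curvature_eq]; rfl
  clear_value C'
  exact ⟨C', h⟩

variable {E' : Type*} [NormedAddCommGroup E'] [NormedSpace ℝ E'] [FiniteDimensional ℝ E']
  {N : Type*} [TopologicalSpace N] [ChartedSpace E' N] [IsManifold 𝓘(ℝ, E') ∞ N]
  [RiemannianBundle (fun p : N ↦ TangentSpace 𝓘(ℝ, E') p)]
  [IsContMDiffRiemannianBundle 𝓘(ℝ, E') ∞ E' (fun p : N ↦ TangentSpace 𝓘(ℝ, E') p)]
  {f : M → N}

/-- The Gauss equation. -/
theorem inner_curvature_eq (hf : IsIsometricImmersion (E := E) (E' := E') f) (x : M)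
    (u v w z : TangentSpace 𝓘(ℝ, E) x) :
    inner ℝ (curvature x u v w) z
      = inner ℝ (curvature (f x) (mfderiv 𝓘(ℝ, E) 𝓘(ℝ, E') f x u)
          (mfderiv 𝓘(ℝ, E) 𝓘(ℝ, E') f x v) (mfderiv 𝓘(ℝ, E) 𝓘(ℝ, E') f x w))
          (mfderiv 𝓘(ℝ, E) 𝓘(ℝ, E') f x z)
        + inner ℝ (secondFundamentalForm (E' := E') f v w) (secondFundamentalForm f u z)
        - inner ℝ (secondFundamentalForm (E' := E') f u w) (secondFundamentalForm f v z) := by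
  have hF := contDiffAt_writtenInExtChartAt hf.contMDiff x
  have hFx := writtenInExtChartAt_self (E := E) (E' := E') f x
  have hF' := fderiv_writtenInExtChartAt hf.contMDiff x
  have hG := contDiffAt_chartMetric (E := E') (f x)
  have hg := contDiffAt_chartMetric (E := E) x
  have hGi := isInvertible_chartMetric (E := E') (f x)
  have hgi := isInvertible_chartMetric (E := E) x
  rw [← hFx] at hG hGi
  have hGs : ∀ᶠ p in 𝓝 (writtenInExtChartAt 𝓘(ℝ, E) 𝓘(ℝ, E') x f (extChartAt 𝓘(ℝ, E) x x)),
      ∀ a b, chartMetric (f x) p a b = chartMetric (f x) p b a :=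
    .of_forall fun z => chartMetric_symm (f x) z
  have hpull := chartMetric_pullback hf x
  have hfirst (a b c : E) := christoffelFirstMap_pullback
    (hF.of_le (m := 2) (WithTop.coe_le_coe.2 le_top)) (hG.differentiableAt (by simp))
    (hg.differentiableAt (by simp)) hGs hGi hpull a b c
  simp only [hFx, ← metric_christoffelMap hgi, chartMetric_self] at hfirst
  set A := alongDerivative (chartMetric (f x)) (writtenInExtChartAt 𝓘(ℝ, E) 𝓘(ℝ, E') x f)
    (extChartAt 𝓘(ℝ, E) x x) with hA
  set Γ := christoffelMap (chartMetric x) (extChartAt 𝓘(ℝ, E) x x) with hΓ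
  rw [hF'] at hfirst
  -- By `hfirst` the tangential part of `A a b` is `df (Γ a b)`; its normal part is the second
  -- fundamental form.
  have hnormal (a b c d : E) :
      modelInner (E := E') (f x) (A a b) (A c d) = modelInner (E := E) x (Γ a b) (Γ c d)
        + inner ℝ (secondFundamentalForm (E := E) (E' := E') (x := x) f a b)
            (secondFundamentalForm (E := E) (E' := E') (x := x) f c d) := by
    have key (a b : E) : ∀ z ∈ tangentImage (E := E) (E' := E') f x,
        inner ℝ (ambientDerivative (E := E) (E' := E') (x := x) f a b) z
          = inner ℝ (mfderiv 𝓘(ℝ, E) 𝓘(ℝ, E') f x (Γ a b)) z := by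
      rintro _ ⟨c, rfl⟩
      have h1 : modelInner (E := E') (f x) (A a b) (mfderiv 𝓘(ℝ, E) 𝓘(ℝ, E') f x c)
          = inner ℝ (mfderiv 𝓘(ℝ, E) 𝓘(ℝ, E') f x (Γ a b)) (mfderiv 𝓘(ℝ, E) 𝓘(ℝ, E') f x c) :=
        (hfirst a b c).symm.trans (hf.inner_eq x _ c).symm
      rwa [hA, ← ambientDerivative_eq] at h1
    have h2 := inner_eq_add_inner_starProjection_orthogonal
      (tangentImage (E := E) (E' := E') f x) (LinearMap.mem_range_self _ _)
      (LinearMap.mem_range_self _ _) (key a b) (key c d)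
    have h3 : modelInner (E := E') (f x) (A a b) (A c d)
        = inner ℝ (ambientDerivative (E := E) (E' := E') (x := x) f a b)
          (ambientDerivative (E := E) (E' := E') (x := x) f c d) := by
      rw [hA, ← ambientDerivative_eq, ← ambientDerivative_eq]
      rfl
    refine h3.trans (h2.trans ?_)
    congr 1
    exact hf.inner_eq x _ _
  have main (u v w z : E) :
      modelInner (E := E) x (curvature (E := E) x u v w) z
        = modelInner (E := E') (f x) (curvature (E := E') (f x)
            (fderiv ℝ (writtenInExtChartAt 𝓘(ℝ, E) 𝓘(ℝ, E') x f) (extChartAt 𝓘(ℝ, E) x x) u)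
            (fderiv ℝ (writtenInExtChartAt 𝓘(ℝ, E) 𝓘(ℝ, E') x f) (extChartAt 𝓘(ℝ, E) x x) v)
            (fderiv ℝ (writtenInExtChartAt 𝓘(ℝ, E) 𝓘(ℝ, E') x f) (extChartAt 𝓘(ℝ, E) x x) w))
            (fderiv ℝ (writtenInExtChartAt 𝓘(ℝ, E) 𝓘(ℝ, E') x f) (extChartAt 𝓘(ℝ, E) x x) z)
          + inner ℝ (secondFundamentalForm (E := E) (E' := E') (x := x) f v w)
              (secondFundamentalForm (E := E) (E' := E') (x := x) f u z)
          - inner ℝ (secondFundamentalForm (E := E) (E' := E') (x := x) f u w)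
              (secondFundamentalForm (E := E) (E' := E') (x := x) f v z) := by
    -- The products of `A` split by `hnormal`; their tangential parts cancel the products of `Γ`,
    -- leaving only the terms in `h`.
    have gauss := gauss_alongDerivative hF hG hg hGs hgi hGi hpull u v w z
    simp only [hFx, chartMetric_self] at gauss
    rw [← hA, ← hΓ, hnormal, hnormal, ← curvature_eq, ← curvature_eq] at gauss
    rw [gauss]
    ring
  rw [hF'] at main
  exact main u v w z

end Gauss

/-! ### Basis independence of traces, and compactness of frames. -/

section OrthonormalFrames

variable {T : Type*} [NormedAddCommGroup T] [InnerProductSpace ℝ T] [FiniteDimensional ℝ T]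

/-- Both sums are images under `B` of the canonical tensor `∑ eᵢ ⊗ eᵢ` of `V`, which does not depend
on the orthonormal basis. -/
theorem sum_stdOrthonormalBasis_eq {F ι : Type*} [AddCommGroup F] [Module ℝ F] [Fintype ι]
    (B : T →ₗ[ℝ] T →ₗ[ℝ] F) {V : Submodule ℝ T} {e : ι → T} (he : Orthonormal ℝ e)
    (hV : Submodule.span ℝ (Set.range e) = V) :
    ∑ a, B (stdOrthonormalBasis ℝ V a) (stdOrthonormalBasis ℝ V a) = ∑ i, B (e i) (e i) := by
  subst hV
  set V := Submodule.span ℝ (Set.range e)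
  have he' : ∀ i, e i ∈ V := fun i => Submodule.subset_span ⟨i, rfl⟩
  have ho : Orthonormal ℝ (fun i => (⟨e i, he' i⟩ : V)) :=
    he.codRestrict V he'
  have hs : ⊤ ≤ Submodule.span ℝ (Set.range (fun i => (⟨e i, he' i⟩ : V))) := by
    have h1 : Submodule.map V.subtype (Submodule.span ℝ (Set.range (fun i => (⟨e i, he' i⟩ : V))))
        = V := by
      rw [Submodule.map_span, ← Set.range_comp]
      rfl
    rw [← Submodule.map_le_map_iff_of_injective V.injective_subtype, h1, Submodule.map_subtype_top]
  let b := OrthonormalBasis.mk ho hs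
  have hb : ∀ i, (b i : T) = e i := fun i => by simp [b]
  have key := (InnerProductSpace.canonicalCovariantTensor_eq_sum V (stdOrthonormalBasis ℝ V)).symm.trans
    (InnerProductSpace.canonicalCovariantTensor_eq_sum V b)
  have := congrArg (TensorProduct.lift (B.domRestrict₁₂ V V)) key
  simpa [hb, LinearMap.domRestrict₁₂_apply] using this

variable {ι : Type*} {n : ι → ℕ}

theorem exists_orthonormal_frame [DecidableEq ι] {V : ι → Submodule ℝ T}
    (hd : ∀ i, Module.finrank ℝ (V i) = n i) (ho : ∀ i j, i ≠ j → V i ⟂ V j) :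
    ∃ e : (Σ i, Fin (n i)) → T, Orthonormal ℝ e ∧
      ∀ i, Submodule.span ℝ (Set.range fun a => e ⟨i, a⟩) = V i := by
  let b (i : ι) : OrthonormalBasis (Fin (n i)) ℝ (V i) :=
    (stdOrthonormalBasis ℝ (V i)).reindex (finCongr (hd i))
  have hof : OrthogonalFamily ℝ (fun i => V i) fun i => (V i).subtypeₗᵢ :=
    OrthogonalFamily.of_pairwise fun i j hij => ho i j hij
  refine ⟨fun p => b p.1 p.2, hof.orthonormal_sigma_orthonormal fun i => (b i).orthonormal,
    fun i => ?_⟩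
  have h1 := congrArg (Submodule.map (V i).subtype) (b i).toBasis.span_eq
  rw [Submodule.map_span, ← Set.range_comp, Submodule.map_subtype_top] at h1
  simpa [Function.comp_def] using h1

theorem isCompact_orthonormal {κ : Type*} [Finite κ] (D : Submodule ℝ T) :
    IsCompact {e : κ → T | Orthonormal ℝ e ∧ ∀ p, e p ∈ D} := by
  classical
  have := Fintype.ofFinite κ
  have : ProperSpace T := FiniteDimensional.proper_real T
  refine Metric.isCompact_of_isClosed_isBounded ?_ ?_
  · simp only [orthonormal_iff_ite, Set.ofPred_and, Set.ofPred_forall]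
    refine IsClosed.inter (isClosed_iInter fun i => isClosed_iInter fun j => ?_)
      (isClosed_iInter fun p => ?_)
    · exact isClosed_eq (by fun_prop) continuous_const
    · exact D.closed_of_finiteDimensional.preimage (continuous_apply p)
  · refine (Metric.isBounded_closedBall (x := (0 : κ → T)) (r := 1)).subset fun e he => ?_
    rw [mem_closedBall_zero_iff, pi_norm_le_iff_of_nonneg zero_le_one]
    exact fun p => (he.1.1 p).le

theorem exists_orthonormal_mem {κ : Type*} [Fintype κ] (D : Submodule ℝ T)
    (h : Fintype.card κ ≤ Module.finrank ℝ D) :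
    ∃ e : κ → T, Orthonormal ℝ e ∧ ∀ p, e p ∈ D := by
  obtain ⟨g⟩ := Function.Embedding.nonempty_of_card_le
    (h.trans_eq (Fintype.card_fin (Module.finrank ℝ D)).symm)
  exact ⟨fun p => stdOrthonormalBasis ℝ D (g p),
    ((stdOrthonormalBasis ℝ D).orthonormal.comp g g.injective).comp_linearIsometry D.subtypeₗᵢ,
    fun p => Subtype.prop _⟩

/-- Orthonormal frames in `D`, cut into blocks of sizes `n i`, map onto the orthogonal systems. Thus
`Φ` is maximised as a continuous function on a compact set, nonempty by `hn`. -/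
theorem exists_isGreatest_of_frame [Fintype ι] [DecidableEq ι] (D : Submodule ℝ T)
    (hn : ∑ i, n i ≤ Module.finrank ℝ D)
    (Φ : (ι → Submodule ℝ T) → ℝ) (φ : ((Σ i, Fin (n i)) → T) → ℝ) (hφ : Continuous φ)
    (hΦ : ∀ e, Orthonormal ℝ e → ∀ V : ι → Submodule ℝ T,
      (∀ i, Submodule.span ℝ (Set.range fun a => e ⟨i, a⟩) = V i) → Φ V = φ e) :
    ∃ m, IsGreatest {r | ∃ V : ι → Submodule ℝ T, ((∀ i, V i ≤ D) ∧
      (∀ i, Module.finrank ℝ (V i) = n i) ∧ ∀ i j, i ≠ j → V i ⟂ V j) ∧ Φ V = r} m := by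
  set S : Set ℝ := {r | ∃ V : ι → Submodule ℝ T, ((∀ i, V i ≤ D) ∧
      (∀ i, Module.finrank ℝ (V i) = n i) ∧ ∀ i j, i ≠ j → V i ⟂ V j) ∧ Φ V = r}
  have hS : S = φ '' {e | Orthonormal ℝ e ∧ ∀ p, e p ∈ D} := by
    ext r
    constructor
    · rintro ⟨V, ⟨h1, h2, h3⟩, rfl⟩
      obtain ⟨e, he, hV⟩ := exists_orthonormal_frame h2 h3
      refine ⟨e, ⟨he, fun p => h1 p.1 ?_⟩, (hΦ e he V hV).symm⟩
      rw [← hV]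
      exact Submodule.subset_span ⟨p.2, rfl⟩
    · rintro ⟨e, ⟨he, hD⟩, rfl⟩
      refine ⟨fun i => Submodule.span ℝ (Set.range fun a => e ⟨i, a⟩), ⟨fun i => ?_, fun i => ?_,
        fun i j hij => ?_⟩, hΦ e he _ fun _ => rfl⟩
      · rw [Submodule.span_le]
        rintro _ ⟨a, rfl⟩
        exact hD _
      · exact (finrank_span_eq_card
          (he.comp (Sigma.mk i) sigma_mk_injective).linearIndependent).trans (Fintype.card_fin _)
      · rw [Submodule.isOrtho_span]
        rintro _ ⟨a, rfl⟩ _ ⟨b, rfl⟩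
        exact he.2 (by simp [hij])
  have hne : ({e : (Σ i, Fin (n i)) → T | Orthonormal ℝ e ∧ ∀ p, e p ∈ D}).Nonempty :=
    exists_orthonormal_mem D (by simpa using hn)
  rw [hS]
  exact ((isCompact_orthonormal D).image hφ).exists_isGreatest (hne.image φ)

end OrthonormalFrames

/-! ### Mutual curvature and mean curvature as traces of multilinear maps. -/

section TraceForms

variable {T : Type*} [NormedAddCommGroup T] [InnerProductSpace ℝ T] [FiniteDimensional ℝ T]
  {T' : Type*} [NormedAddCommGroup T'] [InnerProductSpace ℝ T']

/-- The mutual curvature of a pair of subspaces for the curvature tensor `R`. -/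
def pairTrace (R : T →ₗ[ℝ] T →ₗ[ℝ] T →ₗ[ℝ] T) (V W : Submodule ℝ T) : ℝ :=
  ∑ a, ∑ b, inner ℝ (R (stdOrthonormalBasis ℝ V a) (stdOrthonormalBasis ℝ W b)
    (stdOrthonormalBasis ℝ W b)) (stdOrthonormalBasis ℝ V a : T)

/-- The mutual curvature of a family of subspaces for the curvature tensor `R`. -/
def mutualTrace (R : T →ₗ[ℝ] T →ₗ[ℝ] T →ₗ[ℝ] T) {k : ℕ} (V : Fin k → Submodule ℝ T) : ℝ :=
  ∑ i, ∑ j ∈ Finset.Ioi i, pairTrace R (V i) (V j)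

/-- The trace of the bilinear map `h` on a subspace. -/
def subspaceTrace (h : T →ₗ[ℝ] T →ₗ[ℝ] T') (V : Submodule ℝ T) : T' :=
  ∑ a, h (stdOrthonormalBasis ℝ V a) (stdOrthonormalBasis ℝ V a)

theorem pairTrace_eq {ι κ : Type*} [Fintype ι] [Fintype κ] (R : T →ₗ[ℝ] T →ₗ[ℝ] T →ₗ[ℝ] T)
    {V W : Submodule ℝ T} {e : ι → T} {e' : κ → T} (he : Orthonormal ℝ e) (he' : Orthonormal ℝ e')
    (hV : Submodule.span ℝ (Set.range e) = V) (hW : Submodule.span ℝ (Set.range e') = W) :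
    pairTrace R V W = ∑ a, ∑ b, inner ℝ (R (e a) (e' b) (e' b)) (e a) := by
  have h1 (u : T) : ∑ b, inner ℝ (R u (stdOrthonormalBasis ℝ W b) (stdOrthonormalBasis ℝ W b)) u
      = ∑ b, inner ℝ (R u (e' b) (e' b)) u := by
    have := sum_stdOrthonormalBasis_eq (R u) he' hW
    rw [← sum_inner, this, sum_inner]
  have h2 (v : T) : ∑ a, inner ℝ (R (stdOrthonormalBasis ℝ V a : T) v v)
      (stdOrthonormalBasis ℝ V a : T) = ∑ a, inner ℝ (R (e a) v v) (e a) := by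
    let B : T →ₗ[ℝ] T →ₗ[ℝ] ℝ := (innerₗ T).comp (((R.flip v)).flip v)
    exact sum_stdOrthonormalBasis_eq B he hV
  rw [pairTrace]
  simp only [h1]
  rw [Finset.sum_comm]
  simp only [h2]
  rw [Finset.sum_comm]

theorem subspaceTrace_eq {ι : Type*} [Fintype ι] (h : T →ₗ[ℝ] T →ₗ[ℝ] T')
    {V : Submodule ℝ T} {e : ι → T} (he : Orthonormal ℝ e)
    (hV : Submodule.span ℝ (Set.range e) = V) :
    subspaceTrace h V = ∑ i, h (e i) (e i) :=
  sum_stdOrthonormalBasis_eq h he hV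

theorem continuous_apply₃ (R : T →ₗ[ℝ] T →ₗ[ℝ] T →ₗ[ℝ] T) :
    Continuous fun p : T × T × T => R p.1 p.2.1 p.2.2 := by
  let B : T →ₗ[ℝ] T →ₗ[ℝ] (T →L[ℝ] T) := R.compr₂ LinearMap.toContinuousLinearMap.toLinearMap
  exact (B.toContinuousBilinearMap.continuous₂.comp (continuous_fst.prodMk
    (continuous_fst.comp continuous_snd))).clm_apply (continuous_snd.comp continuous_snd)

theorem continuous_apply₂ (h : T →ₗ[ℝ] T →ₗ[ℝ] T') : Continuous fun p : T × T => h p.1 p.2 :=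
  h.toContinuousBilinearMap.continuous₂

theorem exists_isGreatest_mutualTrace (R : T →ₗ[ℝ] T →ₗ[ℝ] T →ₗ[ℝ] T) {k : ℕ} (n : Fin k → ℕ)
    (D : Submodule ℝ T) (hn : ∑ i, n i ≤ Module.finrank ℝ D) :
    ∃ m, IsGreatest {r | ∃ V : Fin k → Submodule ℝ T, ((∀ i, V i ≤ D) ∧
      (∀ i, Module.finrank ℝ (V i) = n i) ∧ ∀ i j, i ≠ j → V i ⟂ V j) ∧ mutualTrace R V = r}
      m := by
  refine exists_isGreatest_of_frame D hn (mutualTrace R)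
    (fun e => ∑ i, ∑ j ∈ Finset.Ioi i, ∑ a, ∑ b,
      inner ℝ (R (e ⟨i, a⟩) (e ⟨j, b⟩) (e ⟨j, b⟩)) (e ⟨i, a⟩)) ?_ ?_
  · refine continuous_finsetSum _ fun i _ => continuous_finsetSum _ fun j _ =>
      continuous_finsetSum _ fun a _ => continuous_finsetSum _ fun b _ => ?_
    have hc (p : Σ i, Fin (n i)) : Continuous fun e : (Σ i, Fin (n i)) → T => e p :=
      continuous_apply p
    exact ((continuous_apply₃ R).comp ((hc ⟨i, a⟩).prodMk
      ((hc ⟨j, b⟩).prodMk (hc ⟨j, b⟩)))).inner (hc ⟨i, a⟩)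
  · intro e he V hV
    unfold mutualTrace
    refine Finset.sum_congr rfl fun i _ => Finset.sum_congr rfl fun j _ => ?_
    exact pairTrace_eq R (he.comp (Sigma.mk i) sigma_mk_injective)
      (he.comp (Sigma.mk j) sigma_mk_injective) (hV i) (hV j)

theorem exists_isGreatest_norm_subspaceTrace (h : T →ₗ[ℝ] T →ₗ[ℝ] T') (s : ℕ)
    (D : Submodule ℝ T) (hs : s ≤ Module.finrank ℝ D) :
    ∃ m, IsGreatest {r | ∃ V : Submodule ℝ T, V ≤ D ∧ Module.finrank ℝ V = s ∧
      ‖subspaceTrace h V‖ = r} m := by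
  -- A single subspace is an orthogonal system indexed by `Unit`.
  have key := exists_isGreatest_of_frame (ι := Unit) (n := fun _ => s) D (by simpa using hs)
    (fun V => ‖subspaceTrace h (V ())‖)
    (fun e => ‖∑ a, h (e ⟨(), a⟩) (e ⟨(), a⟩)‖) ?_ ?_
  · convert! key using 3 with m
    · ext r
      constructor
      · rintro ⟨V, h1, h2, h3⟩
        exact ⟨fun _ => V, ⟨fun _ => h1, fun _ => h2, fun _ _ hij => (hij rfl).elim⟩, h3⟩
      · rintro ⟨V, ⟨h1, h2, _⟩, h3⟩
        exact ⟨V (), h1 (), h2 (), h3⟩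
  · refine (continuous_finsetSum _ fun a _ => ?_).norm
    have hc (p : Σ _ : Unit, Fin s) : Continuous fun e : (Σ _ : Unit, Fin s) → T => e p :=
      continuous_apply p
    exact (continuous_apply₂ h).comp ((hc ⟨(), a⟩).prodMk (hc ⟨(), a⟩))
  · intro e he V hV
    rw [subspaceTrace_eq h (he.comp (Sigma.mk ()) sigma_mk_injective) (hV ())]
    rfl

end TraceForms

/-! ### The algebraic identity behind the constant `(k - 1) / (2k)`. -/

section PairSums

variable {T' : Type*} [NormedAddCommGroup T'] [InnerProductSpace ℝ T']

theorem sum_sum_eq_diag_add_two_mul {k : ℕ} (g : Fin k → Fin k → ℝ) (hg : ∀ i j, g i j = g j i) :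
    ∑ i, ∑ j, g i j = ∑ i, g i i + 2 * ∑ i, ∑ j ∈ Finset.Ioi i, g i j := by
  have h1 := Finset.sum_sum_Ioi_add_eq_sum_sum_off_diag g
  have h2 : ∑ i, ∑ j ∈ Finset.Ioi i, (g j i + g i j) = 2 * ∑ i, ∑ j ∈ Finset.Ioi i, g i j := by
    simp only [Finset.mul_sum]
    exact Finset.sum_congr rfl fun i _ => Finset.sum_congr rfl fun j _ => by rw [hg j i]; ring
  rw [← h2, h1, ← Finset.sum_add_distrib]
  refine Finset.sum_congr rfl fun i _ => ?_
  rw [← Finset.sum_add_sum_compl {i}, Finset.sum_singleton]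
  exact congrArg _ (Finset.sum_congr rfl fun j _ => hg i j)

/-- Expand `‖∑ H i‖²` and `∑ ‖H i - H j‖²`, then eliminate `∑ ‖H i‖²` between the two. -/
theorem sum_Ioi_inner_eq {k : ℕ} (hk : 0 < k) (H : Fin k → T') :
    ∑ i, ∑ j ∈ Finset.Ioi i, inner ℝ (H i) (H j)
      = ((k : ℝ) - 1) / (2 * k) * ‖∑ i, H i‖ ^ 2
        - 1 / (2 * k) * ∑ i, ∑ j ∈ Finset.Ioi i, ‖H i - H j‖ ^ 2 := by
  have hk' : (k : ℝ) ≠ 0 := by positivity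
  have h1 := sum_sum_eq_diag_add_two_mul (fun i j => inner ℝ (H i) (H j))
    fun i j => real_inner_comm _ _
  have h2 := sum_sum_eq_diag_add_two_mul (fun i j => ‖H i - H j‖ ^ 2)
    fun i j => by rw [norm_sub_rev]
  have h3 : ∑ i, ∑ j, inner ℝ (H i) (H j) = ‖∑ i, H i‖ ^ 2 := by
    rw [← real_inner_self_eq_norm_sq, sum_inner]
    simp only [inner_sum]
  have h4 : ∑ i, ∑ j, ‖H i - H j‖ ^ 2
      = 2 * k * ∑ i, ‖H i‖ ^ 2 - 2 * ∑ i, ∑ j, inner ℝ (H i) (H j) := by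
    simp only [norm_sub_sq_real, Finset.sum_add_distrib, Finset.sum_sub_distrib,
      Finset.sum_const, Finset.card_univ, Fintype.card_fin, nsmul_eq_mul, ← Finset.mul_sum]
    ring
  simp only [real_inner_self_eq_norm_sq, sub_self, norm_zero] at h1 h2
  simp only [ne_eq, OfNat.ofNat_ne_zero, not_false_eq_true, zero_pow, Finset.sum_const_zero,
    zero_add] at h2
  rw [h3] at h1 h4
  rw [h4] at h2
  field_simp
  linear_combination (-1 / 2) * h2 - (k : ℝ) * h1

end PairSums

/-! ### The inequality at a point, from the algebraic Gauss equation. -/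

section ExtrinsicInequality

variable {T : Type*} [NormedAddCommGroup T] [InnerProductSpace ℝ T] [FiniteDimensional ℝ T]
  {T' : Type*} [NormedAddCommGroup T'] [InnerProductSpace ℝ T'] [FiniteDimensional ℝ T']

/-- The squared norm of the restriction of `h` to a pair of subspaces. -/
def pairNormSq (h : T →ₗ[ℝ] T →ₗ[ℝ] T') (V W : Submodule ℝ T) : ℝ :=
  ∑ a, ∑ b, ‖h (stdOrthonormalBasis ℝ V a) (stdOrthonormalBasis ℝ W b)‖ ^ 2

omit [FiniteDimensional ℝ T'] in
theorem pairNormSq_nonneg (h : T →ₗ[ℝ] T →ₗ[ℝ] T') (V W : Submodule ℝ T) :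
    0 ≤ pairNormSq h V W := by
  unfold pairNormSq
  positivity

omit [FiniteDimensional ℝ T'] in
theorem pairNormSq_eq_zero_iff (h : T →ₗ[ℝ] T →ₗ[ℝ] T') (V W : Submodule ℝ T) :
    pairNormSq h V W = 0 ↔ ∀ X ∈ V, ∀ Y ∈ W, h X Y = 0 := by
  have hspan (V : Submodule ℝ T) :
      Submodule.span ℝ (Set.range fun a => (stdOrthonormalBasis ℝ V a : T)) = V := by
    have h1 := congrArg (Submodule.map V.subtype) (stdOrthonormalBasis ℝ V).toBasis.span_eq
    rw [Submodule.map_span, ← Set.range_comp, Submodule.map_subtype_top] at h1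
    simpa [Function.comp_def] using h1
  constructor
  · intro h0 X hX Y hY
    have hb : ∀ a b, h (stdOrthonormalBasis ℝ V a) (stdOrthonormalBasis ℝ W b) = 0 := by
      intro a b
      have h1 := (Finset.sum_eq_zero_iff_of_nonneg fun a _ => by positivity).1 h0 a
        (Finset.mem_univ a)
      have h2 := (Finset.sum_eq_zero_iff_of_nonneg fun b _ => by positivity).1 h1 b
        (Finset.mem_univ b)
      simpa using h2
    rw [← hspan V] at hX
    rw [← hspan W] at hY
    induction hX using Submodule.span_induction with
    | mem X hX =>
      obtain ⟨a, rfl⟩ := hX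
      induction hY using Submodule.span_induction with
      | mem Y hY => obtain ⟨b, rfl⟩ := hY; exact hb a b
      | zero => simp
      | add _ _ _ _ h1 h2 => rw [map_add, h1, h2, add_zero]
      | smul c _ _ h1 => rw [map_smul, h1, smul_zero]
    | zero => simp
    | add _ _ _ _ h1 h2 => rw [map_add, LinearMap.add_apply, h1, h2, add_zero]
    | smul c _ _ h1 => rw [map_smul, LinearMap.smul_apply, h1, smul_zero]
  · intro h0
    refine Finset.sum_eq_zero fun a _ => Finset.sum_eq_zero fun b _ => ?_
    rw [h0 _ (Subtype.prop _) _ (Subtype.prop _), norm_zero, zero_pow two_ne_zero]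

variable {R : T →ₗ[ℝ] T →ₗ[ℝ] T →ₗ[ℝ] T} {R' : T' →ₗ[ℝ] T' →ₗ[ℝ] T' →ₗ[ℝ] T'}
  {h : T →ₗ[ℝ] T →ₗ[ℝ] T'} {L : T →ₗ[ℝ] T'}

/-- `L` carries orthonormal bases to orthonormal bases of the images, so the Gauss equation at
`(e_a, e_b, e_b, e_a)` can be summed term by term. -/
theorem pairTrace_eq_of_gauss (hL : ∀ u v, inner ℝ (L u) (L v) = inner ℝ u v)
    (hs : ∀ u v, h u v = h v u)
    (gauss : ∀ u v w z, inner ℝ (R u v w) z = inner ℝ (R' (L u) (L v) (L w)) (L z)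
      + inner ℝ (h v w) (h u z) - inner ℝ (h u w) (h v z)) (V W : Submodule ℝ T) :
    pairTrace R V W = pairTrace R' (V.map L) (W.map L)
      + inner ℝ (subspaceTrace h V) (subspaceTrace h W) - pairNormSq h V W := by
  have horth (V : Submodule ℝ T) :
      Orthonormal ℝ (fun a => L (stdOrthonormalBasis ℝ V a : T)) := by
    classical
    rw [orthonormal_iff_ite]
    intro a b
    rw [hL]
    exact orthonormal_iff_ite.1 (stdOrthonormalBasis ℝ V).orthonormal a b
  have hspan (V : Submodule ℝ T) :
      Submodule.span ℝ (Set.range fun a => L (stdOrthonormalBasis ℝ V a : T)) = V.map L := by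
    have h1 := congrArg (Submodule.map (L.comp V.subtype))
      (stdOrthonormalBasis ℝ V).toBasis.span_eq
    rw [Submodule.map_span, ← Set.range_comp, Submodule.map_comp V.subtype L ⊤,
      Submodule.map_subtype_top] at h1
    simpa [Function.comp_def] using h1
  rw [pairTrace_eq R' (horth V) (horth W) (hspan V) (hspan W), pairTrace, subspaceTrace,
    subspaceTrace, sum_inner, pairNormSq]
  simp only [inner_sum, ← Finset.sum_add_distrib, ← Finset.sum_sub_distrib]
  refine Finset.sum_congr rfl fun a _ => Finset.sum_congr rfl fun b _ => ?_
  rw [gauss, hs (stdOrthonormalBasis ℝ W b) (stdOrthonormalBasis ℝ V a),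
    real_inner_self_eq_norm_sq, real_inner_comm (h (stdOrthonormalBasis ℝ V a) _)]

-- Orthonormal bases of the `V i` concatenate to one of their sum, so dimensions and traces add.
omit [FiniteDimensional ℝ T'] in
theorem orthogonal_iSup_frame {k : ℕ} {n : Fin k → ℕ} {V : Fin k → Submodule ℝ T}
    (hd : ∀ i, Module.finrank ℝ (V i) = n i) (ho : ∀ i j, i ≠ j → V i ⟂ V j) :
    Module.finrank ℝ (⨆ i, V i : Submodule ℝ T) = ∑ i, n i ∧
      ∀ h : T →ₗ[ℝ] T →ₗ[ℝ] T', subspaceTrace h (⨆ i, V i) = ∑ i, subspaceTrace h (V i) := by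
  obtain ⟨e, he, hV⟩ := exists_orthonormal_frame hd ho
  have hspan : Submodule.span ℝ (Set.range e) = ⨆ i, V i := by
    simp only [← hV, ← Submodule.span_iUnion]
    congr 1
    ext v
    simp
  refine ⟨?_, fun h => ?_⟩
  · rw [← hspan, finrank_span_eq_card he.linearIndependent]
    simp
  · rw [subspaceTrace_eq h he hspan, Fintype.sum_sigma]
    exact Finset.sum_congr rfl fun i _ =>
      (subspaceTrace_eq h (he.comp (Sigma.mk i) sigma_mk_injective) (hV i)).symm

theorem mutualTrace_eq_of_gauss (hL : ∀ u v, inner ℝ (L u) (L v) = inner ℝ u v)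
    (hs : ∀ u v, h u v = h v u)
    (gauss : ∀ u v w z, inner ℝ (R u v w) z = inner ℝ (R' (L u) (L v) (L w)) (L z)
      + inner ℝ (h v w) (h u z) - inner ℝ (h u w) (h v z))
    {k : ℕ} (hk : 0 < k) {n : Fin k → ℕ} {V : Fin k → Submodule ℝ T}
    (hd : ∀ i, Module.finrank ℝ (V i) = n i) (ho : ∀ i j, i ≠ j → V i ⟂ V j) :
    mutualTrace R V = mutualTrace R' (fun i => (V i).map L)
      + ((k : ℝ) - 1) / (2 * k) * ‖subspaceTrace h (⨆ i, V i)‖ ^ 2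
      - (1 / (2 * k) * ∑ i, ∑ j ∈ Finset.Ioi i,
          ‖subspaceTrace h (V i) - subspaceTrace h (V j)‖ ^ 2
        + ∑ i, ∑ j ∈ Finset.Ioi i, pairNormSq h (V i) (V j)) := by
  rw [(orthogonal_iSup_frame hd ho).2 h]
  have h1 := sum_Ioi_inner_eq hk fun i => subspaceTrace h (V i)
  unfold mutualTrace
  simp only [pairTrace_eq_of_gauss hL hs gauss, Finset.sum_add_distrib, Finset.sum_sub_distrib]
  rw [h1]
  ring

omit [FiniteDimensional ℝ T'] in
theorem defect_nonneg (h : T →ₗ[ℝ] T →ₗ[ℝ] T') {k : ℕ} (V : Fin k → Submodule ℝ T) :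
    0 ≤ 1 / (2 * (k : ℝ)) * ∑ i, ∑ j ∈ Finset.Ioi i,
        ‖subspaceTrace h (V i) - subspaceTrace h (V j)‖ ^ 2
      + ∑ i, ∑ j ∈ Finset.Ioi i, pairNormSq h (V i) (V j) := by
  have := fun i j => pairNormSq_nonneg h (V i) (V j)
  exact add_nonneg (by positivity)
    (Finset.sum_nonneg fun i _ => Finset.sum_nonneg fun j _ => this i j)

theorem sum_Ioi_eq_zero_iff {k : ℕ} {g : Fin k → Fin k → ℝ} (hg : ∀ i j, 0 ≤ g i j) :
    ∑ i, ∑ j ∈ Finset.Ioi i, g i j = 0 ↔ ∀ i j, i < j → g i j = 0 := by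
  rw [Finset.sum_eq_zero_iff_of_nonneg fun i _ => Finset.sum_nonneg fun j _ => hg i j]
  simp only [Finset.sum_eq_zero_iff_of_nonneg fun j _ => hg _ j, Finset.mem_univ,
    Finset.mem_Ioi, forall_const]

-- Every summand of the defect is nonnegative, so each vanishes. The sums see only `i < j`; symmetry
-- of `h` and of equality covers the remaining pairs.
omit [FiniteDimensional ℝ T'] in
theorem defect_eq_zero_iff (hs : ∀ u v, h u v = h v u) {k : ℕ} (hk : 0 < k)
    (V : Fin k → Submodule ℝ T) :
    1 / (2 * (k : ℝ)) * ∑ i, ∑ j ∈ Finset.Ioi i,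
        ‖subspaceTrace h (V i) - subspaceTrace h (V j)‖ ^ 2
      + ∑ i, ∑ j ∈ Finset.Ioi i, pairNormSq h (V i) (V j) = 0 ↔
    (∀ i j, i ≠ j → ∀ X ∈ V i, ∀ Y ∈ V j, h X Y = 0) ∧
      ∀ i j, subspaceTrace h (V i) = subspaceTrace h (V j) := by
  have hk' : (1 : ℝ) / (2 * k) ≠ 0 := by positivity
  have hp := fun i j => pairNormSq_nonneg h (V i) (V j)
  rw [add_eq_zero_iff_of_nonneg (by positivity)
    (Finset.sum_nonneg fun i _ => Finset.sum_nonneg fun j _ => hp i j), mul_eq_zero_iff_left hk',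
    sum_Ioi_eq_zero_iff fun i j => by positivity, sum_Ioi_eq_zero_iff hp, and_comm]
  refine and_congr ?_ ?_
  · simp only [pairNormSq_eq_zero_iff]
    refine ⟨fun H i j hij X hX Y hY => ?_, fun H i j hij => H i j hij.ne⟩
    rcases lt_or_gt_of_ne hij with hlt | hgt
    · exact H i j hlt X hX Y hY
    · rw [hs]; exact H j i hgt Y hY X hX
  · simp only [ne_eq, OfNat.ofNat_ne_zero, not_false_eq_true, pow_eq_zero_iff, norm_eq_zero,
      sub_eq_zero]
    refine ⟨fun H i j => ?_, fun H i j _ => H i j⟩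
    rcases lt_trichotomy i j with hlt | rfl | hgt
    · exact H i j hlt
    · rfl
    · exact (H j i hgt).symm

/-- The inequality between intrinsic and extrinsic mutual curvatures and its equality case, for
curvature tensors related by the Gauss equation. -/
theorem mutualTrace_inequality (hL : ∀ u v, inner ℝ (L u) (L v) = inner ℝ u v)
    (hs : ∀ u v, h u v = h v u)
    (gauss : ∀ u v w z, inner ℝ (R u v w) z = inner ℝ (R' (L u) (L v) (L w)) (L z)
      + inner ℝ (h v w) (h u z) - inner ℝ (h u w) (h v z))
    {k : ℕ} (hk : 2 ≤ k) (n : Fin k → ℕ) (D : Submodule ℝ T)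
    (hn : ∑ i, n i ≤ Module.finrank ℝ D) {δ δ' m : ℝ}
    (hδ : IsGreatest {r | ∃ V : Fin k → Submodule ℝ T, ((∀ i, V i ≤ D) ∧
      (∀ i, Module.finrank ℝ (V i) = n i) ∧ ∀ i j, i ≠ j → V i ⟂ V j) ∧ mutualTrace R V = r} δ)
    (hδ' : IsGreatest {r | ∃ V : Fin k → Submodule ℝ T', ((∀ i, V i ≤ ⊤) ∧
      (∀ i, Module.finrank ℝ (V i) = n i) ∧ ∀ i j, i ≠ j → V i ⟂ V j) ∧ mutualTrace R' V = r} δ')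
    (hm : IsGreatest {r | ∃ V : Submodule ℝ T, V ≤ D ∧ Module.finrank ℝ V = ∑ i, n i ∧
      ‖subspaceTrace h V‖ = r} m) :
    δ ≤ δ' + ((k : ℝ) - 1) / (2 * k) * (if ∑ i, n i < Module.finrank ℝ D then m ^ 2
        else ‖subspaceTrace h D‖ ^ 2) ∧
    (δ = δ' + ((k : ℝ) - 1) / (2 * k) * (if ∑ i, n i < Module.finrank ℝ D then m ^ 2
        else ‖subspaceTrace h D‖ ^ 2) ↔
      ∃ V : Fin k → Submodule ℝ T, ((∀ i, V i ≤ D) ∧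
        (∀ i, Module.finrank ℝ (V i) = n i) ∧ ∀ i j, i ≠ j → V i ⟂ V j) ∧
        (∀ i j, i ≠ j → ∀ X ∈ V i, ∀ Y ∈ V j, h X Y = 0) ∧
        (∀ i j, subspaceTrace h (V i) = subspaceTrace h (V j)) ∧
        ‖subspaceTrace h (⨆ i, V i)‖ = m ∧
        mutualTrace R' (fun i => (V i).map L) = δ') := by
  have hk0 : 0 < k := by omega
  -- Strict positivity, from `k ≥ 2`, is what recovers `‖H_V‖ = m` in the equality case.
  have hc : 0 < ((k : ℝ) - 1) / (2 * k) := by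
    have : (2 : ℝ) ≤ k := by exact_mod_cast hk
    exact div_pos (by linarith) (by linarith)
  -- When `s = dim D`, a maximiser of `‖H_V‖` lies in `D` with full dimension and hence is `D`, so
  -- both branches equal `m ^ 2`.
  have hite : (if ∑ i, n i < Module.finrank ℝ D then m ^ 2 else ‖subspaceTrace h D‖ ^ 2)
      = m ^ 2 := by
    split_ifs with hlt
    · rfl
    · obtain ⟨V, h1, h2, h3⟩ := hm.1
      rw [← h3, Submodule.eq_of_le_of_finrank_le h1 (by omega)]
  rw [hite]
  have hm0 : 0 ≤ m := by
    obtain ⟨V, -, -, h3⟩ := hm.1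
    exact h3 ▸ norm_nonneg _
  have hinj : Function.Injective L := by
    rw [injective_iff_map_eq_zero]
    intro u hu
    rw [← inner_self_eq_zero (𝕜 := ℝ), ← hL, hu, inner_zero_left]
  have hR' {V : Fin k → Submodule ℝ T} (hd : ∀ i, Module.finrank ℝ (V i) = n i)
      (ho : ∀ i j, i ≠ j → V i ⟂ V j) : mutualTrace R' (fun i => (V i).map L) ≤ δ' := by
    refine hδ'.2 ⟨_, ⟨fun i => le_top, fun i => ?_, fun i j hij => ?_⟩, rfl⟩
    · exact (Submodule.equivMapOfInjective L hinj (V i)).finrank_eq.symm.trans (hd i)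
    · rw [Submodule.isOrtho_iff_inner_eq]
      rintro _ ⟨u, hu, rfl⟩ _ ⟨v, hv, rfl⟩
      rw [hL]
      exact Submodule.isOrtho_iff_inner_eq.1 (ho i j hij) u hu v hv
  have hH {V : Fin k → Submodule ℝ T} (hle : ∀ i, V i ≤ D)
      (hd : ∀ i, Module.finrank ℝ (V i) = n i)
      (ho : ∀ i j, i ≠ j → V i ⟂ V j) : ‖subspaceTrace h (⨆ i, V i)‖ ≤ m :=
    hm.2 ⟨_, iSup_le hle, (orthogonal_iSup_frame (T' := T') hd ho).1, rfl⟩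
  obtain ⟨V, ⟨hle, hd, ho⟩, hV⟩ := hδ.1
  have hsq := pow_le_pow_left₀ (norm_nonneg _) (hH hle hd ho) 2
  have hmul := mul_le_mul_of_nonneg_left hsq hc.le
  have hEq := mutualTrace_eq_of_gauss hL hs gauss hk0 hd ho
  have hQ := defect_nonneg h V
  have hA := hR' hd ho
  have hineq : δ ≤ δ' + ((k : ℝ) - 1) / (2 * k) * m ^ 2 := by
    rw [← hV, hEq]
    linarith
  refine ⟨hineq, fun heq => ⟨V, ⟨hle, hd, ho⟩, ?_⟩, ?_⟩
  -- The maximiser attains the upper bound, so none of the three estimates `hQ`, `hA`, `hmul` can be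
  -- strict.
  · rw [heq, hEq] at hV
    have hQ0 := (defect_eq_zero_iff hs hk0 V).1 (le_antisymm (by linarith) hQ)
    refine ⟨hQ0.1, hQ0.2, ?_, by linarith⟩
    have h2 : ‖subspaceTrace h (⨆ i, V i)‖ ^ 2 = m ^ 2 :=
      mul_left_cancel₀ hc.ne' (le_antisymm hmul (by linarith))
    exact (pow_left_inj₀ (norm_nonneg _) hm0 two_ne_zero).1 h2
  · rintro ⟨W, ⟨hle, hd, ho⟩, h1, h2, h3, h4⟩
    refine le_antisymm hineq (hδ.2 ⟨W, ⟨hle, hd, ho⟩, ?_⟩)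
    rw [mutualTrace_eq_of_gauss hL hs gauss hk0 hd ho,
      (defect_eq_zero_iff hs hk0 W).2 ⟨h1, h2⟩, h3, h4, sub_zero]

end ExtrinsicInequality

theorem isOrthogonalSystem_iff {E : Type*} [NormedAddCommGroup E] [NormedSpace ℝ E]
    {M : Type*} [TopologicalSpace M] [ChartedSpace E M]
    [RiemannianBundle (fun x : M ↦ TangentSpace 𝓘(ℝ, E) x)] {x : M} {k : ℕ}
    {D : Submodule ℝ (TangentSpace 𝓘(ℝ, E) x)} {n : Fin k → ℕ}
    {V : Fin k → Submodule ℝ (TangentSpace 𝓘(ℝ, E) x)} :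
    IsOrthogonalSystem D n V ↔ (∀ i, V i ≤ D) ∧ (∀ i, Module.finrank ℝ (V i) = n i) ∧
      ∀ i j, i ≠ j → V i ⟂ V j :=
  ⟨fun h => ⟨h.le, h.finrank_eq, h.orthogonal⟩, fun h => ⟨h.1, h.2.1, h.2.2⟩⟩

end CRMutual

end

theorem mainTheorem1
    {E : Type*} [NormedAddCommGroup E] [NormedSpace ℝ E] [FiniteDimensional ℝ E]
    {M : Type*} [TopologicalSpace M] [ChartedSpace E M] [IsManifold 𝓘(ℝ, E) ∞ M]
    [RiemannianBundle (fun x : M ↦ TangentSpace 𝓘(ℝ, E) x)]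
    [IsContMDiffRiemannianBundle 𝓘(ℝ, E) ∞ E (fun x : M ↦ TangentSpace 𝓘(ℝ, E) x)]
    {E' : Type*} [NormedAddCommGroup E'] [NormedSpace ℝ E'] [FiniteDimensional ℝ E']
    {N : Type*} [TopologicalSpace N] [ChartedSpace E' N] [IsManifold 𝓘(ℝ, E') ∞ N]
    [RiemannianBundle (fun p : N ↦ TangentSpace 𝓘(ℝ, E') p)]
    [IsContMDiffRiemannianBundle 𝓘(ℝ, E') ∞ E' (fun p : N ↦ TangentSpace 𝓘(ℝ, E') p)]
    (J : ∀ p : N, TangentSpace 𝓘(ℝ, E') p →L[ℝ] TangentSpace 𝓘(ℝ, E') p)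
    (hJ : CRMutual.IsAlmostHermitian J)
    (f : M → N) (d l : ℕ) (hf : CRMutual.IsCRSubmanifold (E := E) f J d l)
    (k : ℕ) (hk : 2 ≤ k) (n : Fin k → ℕ) (s : ℕ) (hs : ∑ i, n i = s) (hsd : s ≤ d) (x : M) :
    -- the maxima in the definitions of the invariants are attained
    IsGreatest (CRMutual.mutualCurvatureValues (CRMutual.complexPart (E := E) f J x) n)
      (CRMutual.deltaPlus (CRMutual.complexPart (E := E) f J x) n) ∧
    IsGreatest (CRMutual.mutualCurvatureValues
        (⊤ : Submodule ℝ (TangentSpace 𝓘(ℝ, E') (f x))) n)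
      (CRMutual.deltaPlus (⊤ : Submodule ℝ (TangentSpace 𝓘(ℝ, E') (f x))) n) ∧
    IsGreatest (CRMutual.meanCurvatureValues (E' := E') f (CRMutual.complexPart (E := E) f J x) s)
      (CRMutual.maxMeanCurvature (E' := E') f (CRMutual.complexPart (E := E) f J x) s) ∧
    -- the inequality
    CRMutual.deltaPlus (CRMutual.complexPart (E := E) f J x) n ≤
      CRMutual.deltaPlus (⊤ : Submodule ℝ (TangentSpace 𝓘(ℝ, E') (f x))) n
        + ((k : ℝ) - 1) / (2 * k) *
          (if s < d then CRMutual.maxMeanCurvature (E' := E') f (CRMutual.complexPart (E := E) f J x) s ^ 2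
            else ‖CRMutual.meanCurvature (E' := E') f (CRMutual.complexPart (E := E) f J x)‖ ^ 2) ∧
    -- the case of equality
    (CRMutual.deltaPlus (CRMutual.complexPart (E := E) f J x) n =
      CRMutual.deltaPlus (⊤ : Submodule ℝ (TangentSpace 𝓘(ℝ, E') (f x))) n
        + ((k : ℝ) - 1) / (2 * k) *
          (if s < d then CRMutual.maxMeanCurvature (E' := E') f (CRMutual.complexPart (E := E) f J x) s ^ 2
            else ‖CRMutual.meanCurvature (E' := E') f (CRMutual.complexPart (E := E) f J x)‖ ^ 2) ↔
      ∃ V : Fin k → Submodule ℝ (TangentSpace 𝓘(ℝ, E) x),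
        CRMutual.IsOrthogonalSystem (CRMutual.complexPart (E := E) f J x) n V ∧
        CRMutual.IsMixedTotallyGeodesic (E' := E') f V ∧
        (∀ i j, CRMutual.meanCurvature (E' := E') f (V i) = CRMutual.meanCurvature (E' := E') f (V j)) ∧
        ‖CRMutual.meanCurvature (E' := E') f (⨆ i, V i)‖
          = CRMutual.maxMeanCurvature (E' := E') f (CRMutual.complexPart (E := E) f J x) s ∧
        CRMutual.mutualCurvature (fun i ↦ CRMutual.pushSubspace (E' := E') f (V i))
          = CRMutual.deltaPlus (⊤ : Submodule ℝ (TangentSpace 𝓘(ℝ, E') (f x))) n) := by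
  obtain ⟨R, hR⟩ := CRMutual.exists_curvature_linear (E := E) x
  obtain ⟨R', hR'⟩ := CRMutual.exists_curvature_linear (E := E') (f x)
  obtain ⟨h, hh⟩ := CRMutual.exists_secondFundamentalForm_bilinear (E := E) (E' := E') f x
  have hi := hf.isIsometricImmersion
  have hD : Module.finrank ℝ (CRMutual.complexPart (E := E) f J x) = d :=
    hf.finrank_complexPart x
  -- From here `D` enters only as a subspace of dimension `d`.
  generalize CRMutual.complexPart (E := E) f J x = D at hD ⊢
  subst hs
  have hpair (V W : Submodule ℝ (TangentSpace 𝓘(ℝ, E) x)) :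
      CRMutual.mutualCurvaturePair V W = CRMutual.pairTrace R V W := by
    simp only [CRMutual.mutualCurvaturePair, CRMutual.pairTrace, hR]
  have hpair' (V W : Submodule ℝ (TangentSpace 𝓘(ℝ, E') (f x))) :
      CRMutual.mutualCurvaturePair V W = CRMutual.pairTrace R' V W := by
    simp only [CRMutual.mutualCurvaturePair, CRMutual.pairTrace, hR']
  have hmut (V : Fin k → Submodule ℝ (TangentSpace 𝓘(ℝ, E) x)) :
      CRMutual.mutualCurvature V = CRMutual.mutualTrace R V := by
    simp only [CRMutual.mutualCurvature, CRMutual.mutualTrace, hpair]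
  have hmut' (V : Fin k → Submodule ℝ (TangentSpace 𝓘(ℝ, E') (f x))) :
      CRMutual.mutualCurvature V = CRMutual.mutualTrace R' V := by
    simp only [CRMutual.mutualCurvature, CRMutual.mutualTrace, hpair']
  have hmean (V : Submodule ℝ (TangentSpace 𝓘(ℝ, E) x)) :
      CRMutual.meanCurvature (E' := E') f V = CRMutual.subspaceTrace h V := by
    simp only [CRMutual.meanCurvature, CRMutual.subspaceTrace, hh]
  have hval : CRMutual.mutualCurvatureValues D n = {r | ∃ V : Fin k → Submodule ℝ _,
      ((∀ i, V i ≤ D) ∧ (∀ i, Module.finrank ℝ (V i) = n i) ∧ ∀ i j, i ≠ j → V i ⟂ V j) ∧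
        CRMutual.mutualTrace R V = r} := by
    simp only [CRMutual.mutualCurvatureValues, hmut, CRMutual.isOrthogonalSystem_iff]
  have hval' : CRMutual.mutualCurvatureValues (⊤ : Submodule ℝ (TangentSpace 𝓘(ℝ, E') (f x))) n
      = {r | ∃ V : Fin k → Submodule ℝ _,
      ((∀ i, V i ≤ ⊤) ∧ (∀ i, Module.finrank ℝ (V i) = n i) ∧ ∀ i j, i ≠ j → V i ⟂ V j) ∧
        CRMutual.mutualTrace R' V = r} := by
    simp only [CRMutual.mutualCurvatureValues, hmut', CRMutual.isOrthogonalSystem_iff]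
  have hvalm : CRMutual.meanCurvatureValues (E' := E') f D (∑ i, n i)
      = {r | ∃ V : Submodule ℝ _, V ≤ D ∧ Module.finrank ℝ V = ∑ i, n i ∧
        ‖CRMutual.subspaceTrace h V‖ = r} := by
    simp only [CRMutual.meanCurvatureValues, hmean]
  let L : TangentSpace 𝓘(ℝ, E) x →ₗ[ℝ] TangentSpace 𝓘(ℝ, E') (f x) :=
    (mfderiv 𝓘(ℝ, E) 𝓘(ℝ, E') f x).toLinearMap
  have hL : ∀ u v, inner ℝ (L u) (L v) = inner ℝ u v := hi.inner_eq x
  have hinj : Function.Injective L := by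
    rw [injective_iff_map_eq_zero]
    intro u hu
    rw [← inner_self_eq_zero (𝕜 := ℝ), ← hL, hu, inner_zero_left]
  -- Injectivity of `df` gives `s ≤ d = dim D ≤ dim N`, so orthogonal systems exist in the ambient
  -- tangent space too.
  have hfin : ∑ i, n i ≤ Module.finrank ℝ (⊤ : Submodule ℝ (TangentSpace 𝓘(ℝ, E') (f x))) := by
    rw [finrank_top]
    exact (hsd.trans_eq hD.symm).trans
      ((Submodule.finrank_le D).trans (LinearMap.finrank_le_finrank_of_injective hinj))
  have hδ : IsGreatest (CRMutual.mutualCurvatureValues D n) (CRMutual.deltaPlus D n) := by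
    obtain ⟨m, hm⟩ := CRMutual.exists_isGreatest_mutualTrace R n D (hsd.trans_eq hD.symm)
    rw [← hval] at hm
    rwa [CRMutual.deltaPlus, hm.csSup_eq]
  have hδ' : IsGreatest (CRMutual.mutualCurvatureValues
      (⊤ : Submodule ℝ (TangentSpace 𝓘(ℝ, E') (f x))) n) (CRMutual.deltaPlus
        (⊤ : Submodule ℝ (TangentSpace 𝓘(ℝ, E') (f x))) n) := by
    obtain ⟨m, hm⟩ := CRMutual.exists_isGreatest_mutualTrace R' n ⊤ hfin
    rw [← hval'] at hm
    rwa [CRMutual.deltaPlus, hm.csSup_eq]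
  have hH : IsGreatest (CRMutual.meanCurvatureValues (E' := E') f D (∑ i, n i))
      (CRMutual.maxMeanCurvature (E' := E') f D (∑ i, n i)) := by
    obtain ⟨m, hm⟩ := CRMutual.exists_isGreatest_norm_subspaceTrace h (∑ i, n i) D
      (hsd.trans_eq hD.symm)
    rw [← hvalm] at hm
    rwa [CRMutual.maxMeanCurvature, hm.csSup_eq]
  refine ⟨hδ, hδ', hH, ?_⟩
  rw [hval] at hδ
  rw [hval'] at hδ'
  rw [hvalm] at hH
  have hs : ∀ u v, h u v = h v u := fun u v => by
    rw [← hh, ← hh, CRMutual.secondFundamentalForm_symm hi]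
  have gauss : ∀ u v w z, inner ℝ (R u v w) z = inner ℝ (R' (L u) (L v) (L w)) (L z)
      + inner ℝ (h v w) (h u z) - inner ℝ (h u w) (h v z) := fun u v w z => by
    simp only [← hh, ← hR, ← hR']
    exact CRMutual.inner_curvature_eq hi x u v w z
  have key := CRMutual.mutualTrace_inequality hL hs gauss hk n D (hsd.trans_eq hD.symm) hδ hδ' hH
  rw [hD] at key
  simp only [hmean, hmut', CRMutual.isOrthogonalSystem_iff, CRMutual.IsMixedTotallyGeodesic, hh,
    CRMutual.pushSubspace]
  exact key
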